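/- **Setting.** Let $N\ge 0$ be an integer and $q,t\in\mathbb C^\times$ with $|q|<1$ and $q^m t\neq 1$ for all integers $m\ge 1$. Put $Q=t^N$ and $(z;q)_\infty=\prod_{k\ge0}(1-q^kz)$. Fix logarithms $\log q$, $\log t$ of $q$, $t$, and for every $x\in\mathbb C^\times$ a logarithm $\log x$ (not necessarily depending continuously on $x$) with $\log(qx)=\log x+\log q$; put $x^a=e^{a\log x}$. Let $w$ be a complex function on $\mathbb C^\times$ and put $$\omega(x)=x^{\frac{\log t}{\log q}(N-1)}w(x),\qquad \Delta_{q,t}(x)=\prod_{1\le i\ne j\le N}\frac{(x_i/x_j;q)_\infty}{(t\,x_i/x_j;q)_\infty},\qquad I(x)=\Delta_{q,t}(x)\prod_{i=1}^N\omega(x_i).$$ Let $\mathcal C=C_1\times\dots\times C_N$, where each $C_i$ is a finite family of closed piecewise $C^1$ curves in $\mathbb C^\times$. A point is called *regular* for a function of one variable if the function is holomorphic there up to a removable singularity, and *singular* otherwise. Assume: 1. $I$ is regular on the contour: every point of $C_i$ is regular for $\omega$, and $x/y$ is regular for $u\mapsto (u;q)_\infty/(tu;q)_\infty$ whenever $x\in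 C_i$, $y\in C_j$, $i\neq j$. 2. ($q$-shift condition.) Fix $i$ and $x_j\in C_j$ for $j\ne i$, and let $f(z)=\prod_{j\neq i}\frac{t^{-1}z-x_j}{z-x_j}\; I(x)\big|_{x_i=z}$. For every singular point $p\neq0$ of $f$, neither $p$ nor $p/q$ lies on $C_i$, and $C_i$ has the same winding number around $p$ and around $p/q$. (That is, a pole of $f(z)$ is enclosed by $C_i$ exactly as often as the corresponding pole of $f(qz)$.) 3. $\mathsf Z^w:=\oint_{\mathcal C}\prod_i dx_i\, I(x)\neq0$. Write $\langle f\rangle^w=\frac1{\mathsf Z^w}\oint_{\mathcal C}\prod_i dx_i\,I(x)f(x)$, and let $$\mathsf Z^w(\mathbf p)=\Big\langle \exp\Big(\sum_{k\ge1}\frac{1-t^k}{1-q^k}\frac{p_k}{k}\sum_{i=1}^Nx_i^k\Big)\Big\rangle^w\in\mathbb C[[p_1,p_2,\dots]],$$ the expectation value being taken coefficientwise. **Statement.** Suppose there are two non-zero polynomials $M^\pm(z)$ of degree at most $2$ such that, in a punctured neighbourhood of every point of $\mathbb C^\times$, $$\frac{w(z)}{w(q^{-1}z)}=\frac{M^+(z)}{M^-(z)}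 .$$ Let $\hat{\mathsf U}^w(z)=\sum_{m\in\mathbb Z}\hat{\mathsf U}^w_m z^{-m}$ be the current $$\hat{\mathsf U}^w (z) = M^-(z) \Big\{ 1-Q^{-1} \exp\Big( \sum_{k\geq1} (1-q^k)z^{-k} \frac{\partial}{\partial p_k} \Big) \Big\} + q t^{-1} M^+(z) \exp\Big( \sum_{k\geq1} (1-t^{-k})(t/q)^{k}z^{k}\frac{p_k}{k}\Big) \Big\{ 1 - Q \exp\Big( - \sum_{k\geq1} (1-q^{k})(t/q)^{-k}z^{-k} \frac{\partial}{\partial p_k} \Big) \Big\}.$$ Then $$\hat{\mathsf U}_m^{w}\cdot \mathsf Z^{w}(\mathbf p)=0\qquad\text{for all integers } m\ge m_0,$$ with $m_0=0$ in every case, and with $m_0=-1$ if moreover $M^{+}(0)=M^{-}(0)\neq0$. -/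

import Mathlib

open scoped Topology Nat

noncomputable section

namespace QTVirasoro

/-! ### Contours -/

/-- A cycle in the punctured plane `ℂ ∖ {0}`: a finite family of closed curves, each parametrised by
`[0,1]`, continuous, and continuously differentiable with bounded derivative off a finite set of
parameters. -/
structure Cycle where
  /-- the number of closed curves -/
  size : ℕ
  /-- the closed curves -/
  curve : Fin size → ℝ → ℂ
  continuousOn : ∀ c, ContinuousOn (curve c) (Set.Icc 0 1)
  closed : ∀ c, curve c 0 = curve c 1
  piecewiseC1 : ∀ c, ∃ S : Set ℝ, S.Finite ∧ ∃ B : ℝ, ∀ s ∈ Set.Ioo (0 : ℝ) 1 \ S,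
    ContDiffAt ℝ 1 (curve c) s ∧ ‖deriv (curve c) s‖ ≤ B
  ne_zero : ∀ c, ∀ s ∈ Set.Icc (0 : ℝ) 1, curve c s ≠ 0

/-- The set of points lying on a cycle. -/
def Cycle.points (C : Cycle) : Set ℂ := ⋃ c, C.curve c '' Set.Icc 0 1

/-- The contour integral `∮_C f(z) dz`. -/
def Cycle.integral (C : Cycle) (f : ℂ → ℂ) : ℂ :=
  ∑ c, ∫ s in (0 : ℝ)..1, f (C.curve c s) * deriv (C.curve c) s

/-- The winding number `(2πi)⁻¹ ∮_C dz / (z - p)` of the cycle around a point `p` not on it. -/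
def Cycle.index (C : Cycle) (p : ℂ) : ℂ :=
  (2 * (Real.pi : ℂ) * Complex.I)⁻¹ * C.integral fun z => (z - p)⁻¹

/-- The `N`-fold contour integral `∮_{C₁ × ⋯ × C_N} F(x₁,…,x_N) dx₁ ⋯ dx_N`. -/
def multiIntegral {N : ℕ} (C : Fin N → Cycle) (F : (Fin N → ℂ) → ℂ) : ℂ :=
  ∑ c : (∀ j, Fin (C j).size), ∫ s in (Set.Icc 0 1 : Set (Fin N → ℝ)),
    F (fun j => (C j).curve (c j) (s j)) * ∏ j, deriv ((C j).curve (c j)) (s j)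

/-- `f` is holomorphic at `p`, up to a removable singularity (the value of `f` at `p` itself is
irrelevant). Poles, essential singularities and points on branch cuts are not regular. -/
def RegularAt (f : ℂ → ℂ) (p : ℂ) : Prop :=
  ∃ g : ℂ → ℂ, AnalyticAt ℂ g p ∧ ∀ᶠ z in 𝓝[≠] p, f z = g z

/-! ### The `q,t`-deformed matrix model -/

/-- The infinite `q`-Pochhammer symbol `(z;q)_∞ = ∏_{k ≥ 0} (1 - q^k z)`, for `|q| < 1`. -/
def qPoch (q z : ℂ) : ℂ := ∏' k : ℕ, (1 - q ^ k * z)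

/-- The ratio `(u;q)_∞ / (tu;q)_∞`. -/
def kernelFactor (q t u : ℂ) : ℂ := qPoch q u / qPoch q (t * u)

/-- The kernel `Δ_{q,t}(x) = ∏_{i ≠ j} (x_i/x_j;q)_∞ / (t x_i/x_j;q)_∞`. -/
def kernel (q t : ℂ) {N : ℕ} (x : Fin N → ℂ) : ℂ :=
  ∏ i, ∏ j ∈ Finset.univ.erase i, kernelFactor q t (x i / x j)

/-- The one-variable factor `x^{(log t / log q)(N-1)} w(x)` of the integrand. Here `logq`, `logt` are
chosen logarithms of `q`, `t`, and `L x` is the chosen logarithm of `x`. -/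
def weightFactor (logq logt : ℂ) (L : ℂ → ℂ) (N : ℕ) (w : ℂ → ℂ) (x : ℂ) : ℂ :=
  Complex.exp (logt / logq * ((N : ℂ) - 1) * L x) * w x

/-- The integrand `Δ_{q,t}(x) ∏_i ω(x_i)`, with `ω` the one-variable factor. -/
def integrand (q t : ℂ) (ω : ℂ → ℂ) {N : ℕ} (x : Fin N → ℂ) : ℂ :=
  kernel q t x * ∏ i, ω (x i)

/-- The normalisation constant `Z^w`. -/
def partitionFunction (q t : ℂ) (ω : ℂ → ℂ) {N : ℕ} (C : Fin N → Cycle) : ℂ :=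
  multiIntegral C (integrand q t ω)

/-- The normalised expectation value `⟨f⟩^w`. -/
def expectation (q t : ℂ) (ω : ℂ → ℂ) {N : ℕ} (C : Fin N → Cycle) (f : (Fin N → ℂ) → ℂ) : ℂ :=
  (partitionFunction q t ω C)⁻¹ * multiIntegral C fun x => integrand q t ω x * f x

/-- The condition on the contour `C₁ × ⋯ × C_N`.
* The integrand has no singularity on the contour.
* Fix all variables but `x_i` on the contour, and let `f` be the integrand, as a function of
  `z = x_i`, times the factor `∏_{j ≠ i} (t⁻¹ z - x_j)/(z - x_j)` of the `q`-difference operators.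
  If `p ≠ 0` is a singularity of `f(z)`, so that `p/q` is one of `f(qz)`, then neither of the two lies
  on `C_i`, and `C_i` encloses `p/q` exactly as often as it encloses `p`. -/
structure Admissible (q t : ℂ) (ω : ℂ → ℂ) {N : ℕ} (C : Fin N → Cycle) : Prop where
  regular_weight : ∀ i, ∀ x ∈ (C i).points, RegularAt ω x
  regular_kernel : ∀ i j, i ≠ j → ∀ x ∈ (C i).points, ∀ y ∈ (C j).points,
    RegularAt (kernelFactor q t) (x / y)
  qshift : ∀ i, ∀ x : Fin N → ℂ, (∀ j, j ≠ i → x j ∈ (C j).points) → ∀ p : ℂ, p ≠ 0 →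
    ¬ RegularAt (fun z => (∏ j ∈ Finset.univ.erase i, (t⁻¹ * z - x j) / (z - x j)) *
      integrand q t ω (Function.update x i z)) p →
    p ∉ (C i).points ∧ p / q ∉ (C i).points ∧ (C i).index p = (C i).index (p / q)

/-! ### The generating function and the current

Formal power series in the times `p₁, p₂, …` are elements of `MvPowerSeries ℕ+ ℂ`. -/

/-- The coefficient of the monomial `∏ p_k^{μ_k}` in `exp (∑_{k ≥ 1} c_k p_k)`. -/
def expLinearCoeff (c : ℕ+ → ℂ) (μ : ℕ+ →₀ ℕ) : ℂ :=
  μ.prod fun k n => c k ^ n / (n ! : ℂ)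

/-- The generating function
`Z^w(p) = ⟨exp (∑_{k ≥ 1} (1 - t^k)/(1 - q^k) (p_k / k) ∑_i x_i^k)⟩^w`. -/
def generatingFunction (q t : ℂ) (ω : ℂ → ℂ) {N : ℕ} (C : Fin N → Cycle) : MvPowerSeries ℕ+ ℂ :=
  fun μ => expectation q t ω C fun x =>
    expLinearCoeff
      (fun k => (1 - t ^ (k : ℕ)) / (1 - q ^ (k : ℕ)) / ((k : ℕ) : ℂ) * ∑ i, x i ^ (k : ℕ)) μ

/-- The coefficient of `y^n` in `exp (∑_{k ≥ 1} a_k y^k) = ∑_j (∑_k a_k y^k)^j / j!`, that is, the sum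
of `a_{k₁} ⋯ a_{k_j} / j!` over all `(k₁,…,k_j)` with `k₁ + ⋯ + k_j = n`; it is `0` for `n < 0`. -/
def expCoeff {A : Type*} [Ring A] [Algebra ℂ A] (a : ℕ+ → A) (n : ℤ) : A :=
  if 0 ≤ n then
    ∑ κ : Composition n.toNat,
      ((κ.length ! : ℂ)⁻¹) • (κ.blocks.map fun k => a k.toPNat').prod
  else 0

/-- The operator `∂/∂p_k` on formal power series. -/
def dp (k : ℕ+) : Module.End ℂ (MvPowerSeries ℕ+ ℂ) :=
  (MvPowerSeries.pderiv ℂ k).toLinearMap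

/-- The coefficient of `z^{-n}` in `1 - Q⁻¹ exp (∑_{k ≥ 1} (1 - q^k) z^{-k} ∂/∂p_k)`, `Q = t^N`. -/
def minusBracket (q t : ℂ) (N : ℕ) (n : ℤ) : Module.End ℂ (MvPowerSeries ℕ+ ℂ) :=
  (if n = 0 then 1 else 0) - (t ^ N)⁻¹ • expCoeff (fun k => (1 - q ^ (k : ℕ)) • dp k) n

/-- The coefficient of `z^{-n}` in
`1 - Q exp (-∑_{k ≥ 1} (1 - q^k) (t/q)^{-k} z^{-k} ∂/∂p_k)`, `Q = t^N`. -/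
def plusBracket (q t : ℂ) (N : ℕ) (n : ℤ) : Module.End ℂ (MvPowerSeries ℕ+ ℂ) :=
  (if n = 0 then 1 else 0) -
    t ^ N • expCoeff (fun k => (-((1 - q ^ (k : ℕ)) * ((t / q) ^ (k : ℕ))⁻¹)) • dp k) n

/-- The coefficient of `z^a` in `exp (∑_{k ≥ 1} (1 - t^{-k}) (t/q)^k z^k p_k / k)`. -/
def vertexCoeff (q t : ℂ) (a : ℤ) : MvPowerSeries ℕ+ ℂ :=
  expCoeff (fun k => ((1 - (t ^ (k : ℕ))⁻¹) * (t / q) ^ (k : ℕ) / ((k : ℕ) : ℂ)) •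
    (MvPowerSeries.X k : MvPowerSeries ℕ+ ℂ)) a

/-- The mode `Û_m`, that is the coefficient of `z^{-m}`, of the current
`Û(z) = M⁻(z) {1 - Q⁻¹ exp (∑ (1 - q^k) z^{-k} ∂/∂p_k)}
  + q t⁻¹ M⁺(z) exp (∑ (1 - t^{-k}) (t/q)^k z^k p_k / k)
    {1 - Q exp (-∑ (1 - q^k) (t/q)^{-k} z^{-k} ∂/∂p_k)}`,
acting on a formal power series. The sum over `a` has finitely many nonzero terms in each
coefficient, as `vertexCoeff q t a` is homogeneous of weighted degree `a`. -/
def virasoroMode (q t : ℂ) (N : ℕ) (Mplus Mminus : Polynomial ℂ) (m : ℤ)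
    (F : MvPowerSeries ℕ+ ℂ) : MvPowerSeries ℕ+ ℂ := fun μ =>
  (Mminus.sum fun l c => c * MvPowerSeries.coeff μ (minusBracket q t N (l + m) F)) +
  q * t⁻¹ * (Mplus.sum fun l c => c * ∑ᶠ a : ℕ,
    MvPowerSeries.coeff μ (vertexCoeff q t a * plusBracket q t N (l + a + m) F))

end QTVirasoro

end

/-! On the exponential E_x = exp(∑_k (1-t^k)/(1-q^k) (p_k/k) ∑_i x_i^k) every ∂/∂p_k acts as a
scalar, so the two brackets of the current become rational functions of z with poles at z = x_i and
at z = q x_i. Partial fractions (`expCoeff_powerSum`) give their modes n ≥ 0 as (1-t⁻¹) ∑_i A_i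
x_i^n and (1-t) ∑_i B_i (q x_i)^n, where A_i = ∏_{j≠i} (t⁻¹x_i - x_j)/(x_i - x_j) and B_i has t in
place of t⁻¹. At z = q x_i the vertex operator turns E_x into E_{T_i x}, where T_i replaces x_i by q
x_i (`sum_coeff_vertexCoeff_mul`). Hence (`coeff_virasoroMode_expLinear`) U_m E_x = (1-t⁻¹) ∑_i {
A_i M⁻(x_i) x_i^m E_x - q B_i M⁺(q x_i) (q x_i)^m E_{T_i x} }. For m = -1 the modes n = -1 also
enter: they are zero, while the sums over poles are not. The resulting corrections are proportional
to M⁻(0) and M⁺(0) and cancel when these agree.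

Now multiply by I, seen as a function of z = x_i. The relation (u;q)_∞ = (1-u)(qu;q)_∞, the factor
t^{N-1} produced by the power of x in ω, and the equation for w combine into A_i(qz) I(qz) M⁻(qz) =
B_i(z) I(z) M⁺(qz) (`shiftFactor_mul_integrand_shift`). So the i-th term is h(z) - q h(qz) with h =
A_i I M⁻ z^m E. Its integral over C_i is the integral of h over the cycle C_i - qC_i, which by the
q-shift condition has winding number zero around every singularity of h. It vanishes by Cauchy's
theorem in homological form (`integral_eq_zero_of_index_eq_zero`,
`Cycle.integral_eq_integral_shift`).

Each coefficient of U_m F depends on finitely many coefficients of F, so the mode passes under the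
expectation value (`coeffSpan_generatingFunction`). Where two coordinates coincide partial fractions
fail, but I vanishes there. Identities valid only up to removable singularities fail at finitely
many points of a contour, which do not affect the integral (`Cycle.integral_congr`). -/

noncomputable section

namespace QTVirasoro

section

open MeasureTheory Filter Set Metric

/-! ### The homological form of Cauchy's theorem -/

/-- Holomorphy of an integral of a uniformly bounded holomorphic family. -/
theorem differentiableAt_integral_of_bounded_family {X : Type*} [MeasurableSpace X] {μ : Measure X}
    {ρ : X → ℂ} (hρ : Integrable ρ μ) {G : ℂ → X → ℂ} {z₀ : ℂ} {r M : ℝ} (hr : 0 < r)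
    (hmeas : ∀ z ∈ ball z₀ r, AEStronglyMeasurable (G z) μ)
    (hdiff : ∀ x, DifferentiableOn ℂ (fun z => G z x) (ball z₀ r))
    (hbound : ∀ z ∈ ball z₀ r, ∀ x, ‖G z x‖ ≤ M) :
    DifferentiableAt ℂ (fun z => ∫ x, G z x * ρ x ∂μ) z₀ := by
  have hat : ∀ x, ∀ z ∈ ball z₀ r, HasDerivAt (fun z => G z x) (deriv (fun z => G z x) z) z :=
    fun x z hz => ((hdiff x).differentiableAt (isOpen_ball.mem_nhds hz)).hasDerivAt
  have hsub : ball z₀ (r / 2) ⊆ ball z₀ r := ball_subset_ball (by linarith)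
  -- The derivative in z is a pointwise limit of difference quotients along the sequence z₀ + ε n,
  -- each of them measurable in x.
  have hmeas' : AEStronglyMeasurable (fun x => deriv (fun z => G z x) z₀) μ := by
    set ε : ℕ → ℂ := fun n => ((r / 2 / (n + 1) : ℝ) : ℂ) with hε
    have hε0 : ∀ n, ε n ≠ 0 := fun n => by
      simp only [hε, ne_eq, Complex.ofReal_eq_zero]; positivity
    have hεb : ∀ n, z₀ + ε n ∈ ball z₀ r := fun n => by
      rw [mem_ball, dist_eq_norm, add_sub_cancel_left, hε, Complex.norm_real, Real.norm_eq_abs,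
        abs_of_pos (by positivity)]
      calc r / 2 / ((n : ℝ) + 1) ≤ r / 2 := div_le_self (by positivity) (by linarith [n.cast_nonneg (α := ℝ)])
        _ < r := by linarith
    have hlim : Tendsto (fun n => z₀ + ε n) atTop (𝓝[≠] z₀) := by
      refine tendsto_nhdsWithin_iff.2 ⟨?_, Eventually.of_forall fun n => by simp [hε0 n]⟩
      have h0 : Tendsto (fun n : ℕ => r / 2 / ((n : ℝ) + 1)) atTop (𝓝 0) :=
        Tendsto.div_atTop tendsto_const_nhds
          (tendsto_natCast_atTop_atTop.atTop_add tendsto_const_nhds)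
      have := ((Complex.continuous_ofReal.tendsto 0).comp h0).const_add z₀
      simpa [Function.comp_def, hε] using this
    refine aestronglyMeasurable_of_tendsto_ae atTop
      (f := fun n x => (ε n)⁻¹ * (G (z₀ + ε n) x - G z₀ x)) (fun n => ?_)
      (Eventually.of_forall fun x => ?_)
    · exact ((hmeas _ (hεb n)).sub (hmeas _ (mem_ball_self hr))).const_mul _
    · have := (hasDerivAt_iff_tendsto_slope.1 (hat x z₀ (mem_ball_self hr))).comp hlim
      refine this.congr fun n => ?_
      simp [slope_def_field, div_eq_inv_mul]
  refine (hasDerivAt_integral_of_dominated_loc_of_deriv_le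
    (F := fun z x => G z x * ρ x) (F' := fun z x => deriv (fun z => G z x) z * ρ x)
    (bound := fun x => M / (r / 4) * ‖ρ x‖)
    (ball_mem_nhds z₀ (half_pos hr)) ?_ ?_ ?_ ?_ ?_ ?_).2.differentiableAt
  · filter_upwards [ball_mem_nhds z₀ hr] with z hz
    exact (hmeas z hz).mul hρ.1
  · refine (hρ.norm.const_mul M).mono' ((hmeas _ (mem_ball_self hr)).mul hρ.1)
      (Eventually.of_forall fun x => ?_)
    rw [norm_mul]
    exact mul_le_mul_of_nonneg_right (hbound _ (mem_ball_self hr) x) (norm_nonneg _)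
  · exact hmeas'.mul hρ.1
  · refine Eventually.of_forall fun x z hz => ?_
    rw [norm_mul]
    refine mul_le_mul_of_nonneg_right ?_ (norm_nonneg _)
    -- Cauchy's estimate on a circle of radius r/4, which stays inside the ball of radius r because
    -- z is within r/2 of z₀.
    have hcl : closedBall z (r / 4) ⊆ ball z₀ r := fun y hy => by
      have h1 := mem_ball.1 hz
      have h2 := mem_closedBall.1 hy
      exact mem_ball.2 (by linarith [dist_triangle y z z₀])
    refine Complex.norm_deriv_le_of_forall_mem_sphere_norm_le (by positivity)
      (((hdiff x).mono hcl).diffContOnCl_ball subset_rfl)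
      fun y hy => hbound y (hcl (sphere_subset_closedBall hy)) x
  · exact hρ.norm.const_mul _
  · exact Eventually.of_forall fun x z hz => (hat x z (hsub hz)).mul_const _

theorem measurable_comp_of_continuousOn {X : Type*} [MeasurableSpace X] {K : Set ℂ} {f : ℂ → ℂ}
    (hf : ContinuousOn f K) {ζ : X → ℂ} (hζ : Measurable ζ) (hmem : ∀ x, ζ x ∈ K) :
    Measurable fun x => f (ζ x) :=
  hf.domRestrict.measurable.comp (hζ.subtype_mk (h := hmem))

/-- Uniform bound for Dixon's kernel (F z - F ζ)/(z - ζ), including the diagonal. For z within δ of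
ζ the Schwarz lemma bounds it by 2B/δ; farther away the numerator is at most 2B and the denominator
at least δ. -/
theorem exists_bound_dslope {K U : Set ℂ} (hK : IsCompact K) (hU : IsOpen U) (hKU : K ⊆ U)
    {F : ℂ → ℂ} (hF : DifferentiableOn ℂ F U) {z₀ : ℂ} (hz₀ : z₀ ∈ U) :
    ∃ r > 0, ball z₀ r ⊆ U ∧ ∃ M, ∀ z ∈ ball z₀ r, ∀ ζ ∈ K, ‖dslope F ζ z‖ ≤ M := by
  have hL : IsCompact (insert z₀ K) := hK.insert z₀
  obtain ⟨δ, hδ, hsub⟩ := hL.exists_cthickening_subset_open hU (insert_subset hz₀ hKU)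
  have hball : ∀ y ∈ insert z₀ K, ball y δ ⊆ cthickening δ (insert z₀ K) := fun y hy =>
    (ball_subset_thickening hy δ).trans (thickening_subset_cthickening _ _)
  obtain ⟨B, hB⟩ := hL.cthickening.exists_bound_of_continuousOn (hF.continuousOn.mono hsub)
  refine ⟨δ, hδ, (hball z₀ (mem_insert _ _)).trans hsub, 2 * B / δ, fun z hz ζ hζ => ?_⟩
  have hζ' : ζ ∈ insert z₀ K := mem_insert_of_mem _ hζ
  have hζB : ‖F ζ‖ ≤ B := hB ζ (self_subset_cthickening _ hζ')
  have hdist : ∀ y, ‖F y‖ ≤ B → ‖F y - F ζ‖ ≤ 2 * B := fun y hy =>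
    (norm_sub_le _ _).trans (by linarith)
  by_cases hzζ : z ∈ ball ζ δ
  · refine Complex.norm_dslope_le_div_of_mapsTo_ball (hF.mono ((hball ζ hζ').trans hsub))
      (fun y hy => ?_) hzζ
    rw [mem_closedBall, dist_eq_norm]
    exact hdist y (hB y (hball ζ hζ' hy))
  · have hne : z ≠ ζ := fun h => hzζ (h ▸ mem_ball_self hδ)
    rw [dslope_of_ne _ hne, slope_def_field, norm_div]
    rw [mem_ball, dist_eq_norm, not_lt] at hzζ
    exact div_le_div₀ ((norm_nonneg _).trans (hdist z (hB z (hball z₀ (mem_insert _ _) hz))))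
      (hdist z (hB z (hball z₀ (mem_insert _ _) hz))) hδ hzζ

theorem dslope_symm (F : ℂ → ℂ) (a b : ℂ) : dslope F a b = dslope F b a := by
  by_cases h : b = a
  · rw [h]
  · rw [dslope_of_ne _ h, dslope_of_ne _ (Ne.symm h), slope_comm]

section Dixon

variable {X : Type*} [MeasurableSpace X] {μ : Measure X} {ζ ρ : X → ℂ} {K U : Set ℂ}

theorem integrable_comp_mul (hρ : Integrable ρ μ) (hζ : Measurable ζ) (hmem : ∀ x, ζ x ∈ K)
    (hK : IsCompact K) {f : ℂ → ℂ} (hf : ContinuousOn f K) :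
    Integrable (fun x => f (ζ x) * ρ x) μ := by
  obtain ⟨B, hB⟩ := hK.exists_bound_of_continuousOn hf
  exact hρ.bdd_mul (measurable_comp_of_continuousOn hf hζ hmem).aestronglyMeasurable
    (Eventually.of_forall fun x => hB _ (hmem x))

theorem differentiableAt_cauchyTransform (hρ : Integrable ρ μ) (hζ : Measurable ζ)
    (hmem : ∀ x, ζ x ∈ K) (hK : IsCompact K) {F : ℂ → ℂ} (hF : ContinuousOn F K) {z₀ : ℂ}
    (hz₀ : z₀ ∉ K) :
    DifferentiableAt ℂ (fun z => ∫ x, F (ζ x) / (ζ x - z) * ρ x ∂μ) z₀ := by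
  obtain ⟨r, hr, hball⟩ := Metric.isOpen_iff.1 hK.isClosed.isOpen_compl z₀ hz₀
  obtain ⟨B, hB⟩ := hK.exists_bound_of_continuousOn hF
  have hne : ∀ z ∈ ball z₀ (r / 2), ∀ w ∈ K, r / 2 ≤ ‖w - z‖ := fun z hz w hw => by
    by_contra! h
    have h1 := mem_ball.1 hz
    rw [← dist_eq_norm] at h
    exact hball (mem_ball.2 (by linarith [dist_triangle w z z₀] : dist w z₀ < r)) hw
  have hne' : ∀ z ∈ ball z₀ (r / 2), ∀ w ∈ K, w - z ≠ 0 := fun z hz w hw h => by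
    have := hne z hz w hw
    rw [h, norm_zero] at this
    linarith
  refine differentiableAt_integral_of_bounded_family hρ (G := fun z x => F (ζ x) / (ζ x - z))
    (r := r / 2) (M := B / (r / 2)) (by positivity) (fun z hz => ?_) (fun x => ?_)
    (fun z hz x => ?_)
  · refine (measurable_comp_of_continuousOn (f := fun w => F w / (w - z)) ?_ hζ hmem).aestronglyMeasurable
    exact hF.div (by fun_prop) (hne' z hz)
  · intro z hz
    have := hne' z hz _ (hmem x)
    fun_prop (disch := assumption)
  · rw [norm_div]
    exact div_le_div₀ ((norm_nonneg _).trans (hB _ (hmem x))) (hB _ (hmem x)) (by positivity)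
      (hne z hz _ (hmem x))

/-- The Cauchy integral over a closed cycle is locally constant off the cycle. -/
theorem integral_inv_sub_eq_of_near (hρ : Integrable ρ μ) (hζ : Measurable ζ)
    (hmem : ∀ x, ζ x ∈ K) (hK : IsCompact K)
    (hclosed : ∀ g g' : ℂ → ℂ, (∀ z ∈ K, HasDerivAt g (g' z) z) → ContinuousOn g' K →
      ∫ x, g' (ζ x) * ρ x ∂μ = 0)
    {z₀ z : ℂ} (hz : ∀ w ∈ K, ‖z - z₀‖ < ‖w - z₀‖) :
    ∫ x, (ζ x - z)⁻¹ * ρ x ∂μ = ∫ x, (ζ x - z₀)⁻¹ * ρ x ∂μ := by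
  have h0 : ∀ w ∈ K, w - z₀ ≠ 0 := fun w hw h => by
    have := hz w hw
    rw [h, norm_zero] at this
    exact absurd this (not_lt.2 (norm_nonneg _))
  have h1 : ∀ w ∈ K, w - z ≠ 0 := fun w hw h => by
    have := hz w hw
    rw [sub_eq_zero.1 h] at this
    exact lt_irrefl _ this
  have hc0 : ContinuousOn (fun w => (w - z₀)⁻¹) K :=
    ContinuousOn.inv₀ (by fun_prop) h0
  have hc1 : ContinuousOn (fun w => (w - z)⁻¹) K :=
    ContinuousOn.inv₀ (by fun_prop) h1
  rw [← sub_eq_zero, ← integral_sub (integrable_comp_mul hρ hζ hmem hK hc1)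
    (integrable_comp_mul hρ hζ hmem hK hc0)]
  -- The difference of the two Cauchy kernels has the primitive log((w - z)/(w - z₀)). The principal
  -- branch applies because |z - z₀| < |w - z₀| keeps the argument within distance 1 of 1.
  have := hclosed (fun w => Complex.log (1 - (z - z₀) / (w - z₀)))
    (fun w => (w - z)⁻¹ - (w - z₀)⁻¹) (fun w hw => ?_) (hc1.sub hc0)
  · simpa only [sub_mul] using this
  · have hs : (1 - (z - z₀) / (w - z₀)) ∈ Complex.slitPlane := by
      refine Complex.mem_slitPlane_of_norm_lt_one (z := -((z - z₀) / (w - z₀))) ?_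
      rw [norm_neg, norm_div, div_lt_one (norm_pos_iff.2 (h0 w hw))]
      exact hz w hw
    have hd : HasDerivAt (fun w => 1 - (z - z₀) / (w - z₀)) ((z - z₀) / (w - z₀) ^ 2) w := by
      have := (((hasDerivAt_id w).sub_const z₀).inv (h0 w hw)).const_mul (z - z₀)
      have := this.const_sub 1
      refine (this.congr_deriv ?_).congr_of_eventuallyEq ?_
      · simp [id]; ring
      · exact Eventually.of_forall fun y => by simp [div_eq_mul_inv]
    convert hd.clog hs using 1
    have e1 : 1 - (z - z₀) / (w - z₀) = (w - z) / (w - z₀) := by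
      field_simp [h0 w hw]; ring
    rw [e1]
    field_simp [h0 w hw, h1 w hw]
    ring

/-- Here log(1 - w/z) is a single-valued primitive of the Cauchy kernel on K, since |w/z| < 1 there.
-/
theorem integral_inv_sub_eq_zero_of_far
    (hclosed : ∀ g g' : ℂ → ℂ, (∀ z ∈ K, HasDerivAt g (g' z) z) → ContinuousOn g' K →
      ∫ x, g' (ζ x) * ρ x ∂μ = 0)
    {z : ℂ} (hz : ∀ w ∈ K, ‖w‖ < ‖z‖) :
    ∫ x, (ζ x - z)⁻¹ * ρ x ∂μ = 0 := by
  have h1 : ∀ w ∈ K, w - z ≠ 0 := fun w hw h => by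
    have := hz w hw
    rw [sub_eq_zero.1 h] at this
    exact lt_irrefl _ this
  refine hclosed (fun w => Complex.log (1 - w / z)) (fun w => (w - z)⁻¹) (fun w hw => ?_)
    (ContinuousOn.inv₀ (by fun_prop) h1)
  have hz0 : z ≠ 0 := norm_pos_iff.1 ((norm_nonneg _).trans_lt (hz w hw))
  have hs : (1 - w / z) ∈ Complex.slitPlane := by
    refine Complex.mem_slitPlane_of_norm_lt_one (z := -(w / z)) ?_
    rw [norm_neg, norm_div, div_lt_one (norm_pos_iff.2 hz0)]
    exact hz w hw
  have hd : HasDerivAt (fun w => 1 - w / z) (-(1 / z)) w :=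
    ((hasDerivAt_id w).div_const z).const_sub 1
  convert hd.clog hs using 1
  have e1 : 1 - w / z = -(w - z) / z := by field_simp; ring
  rw [e1]
  field_simp [h1 w hw]

/-- **Cauchy's theorem, homological form** (Dixon's proof). The cycle is given by a measurable map
`ζ` into a compact set `K` and an integrable density `ρ` annihilating all exact forms. -/
theorem integral_eq_zero_of_index_eq_zero (hρ : Integrable ρ μ) (hζ : Measurable ζ)
    (hmem : ∀ x, ζ x ∈ K) (hK : IsCompact K)
    (hclosed : ∀ g g' : ℂ → ℂ, (∀ z ∈ K, HasDerivAt g (g' z) z) → ContinuousOn g' K →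
      ∫ x, g' (ζ x) * ρ x ∂μ = 0)
    (hU : IsOpen U) (hKU : K ⊆ U) (h0U : (0 : ℂ) ∉ U)
    (hind : ∀ p ∉ U, ∫ x, (ζ x - p)⁻¹ * ρ x ∂μ = 0)
    {f : ℂ → ℂ} (hf : DifferentiableOn ℂ f U) : ∫ x, f (ζ x) * ρ x ∂μ = 0 := by
  classical
  -- The desired integral is the Cauchy integral of z f(z) at the point 0, which lies outside U.
  set F : ℂ → ℂ := fun z => z * f z with hFdef
  have hF : DifferentiableOn ℂ F U := differentiableOn_id.mul hf
  have hFK : ContinuousOn F K := hF.continuousOn.mono hKU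
  -- Dixon's function. Off K its two formulas differ by F(z) times the integral of the Cauchy
  -- kernel, so they agree where that integral is zero, and H is entire.
  set H : ℂ → ℂ := fun z => if z ∈ U then ∫ x, dslope F (ζ x) z * ρ x ∂μ
    else ∫ x, F (ζ x) / (ζ x - z) * ρ x ∂μ with hH
  have key : ∀ z ∉ K, ∫ x, (ζ x - z)⁻¹ * ρ x ∂μ = 0 →
      H z = ∫ x, F (ζ x) / (ζ x - z) * ρ x ∂μ := by
    intro z hz hi
    by_cases hzU : z ∈ U
    · have hne : ∀ w ∈ K, w - z ≠ 0 := fun w hw h => hz (sub_eq_zero.1 h ▸ hw)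
      have hc1 : ContinuousOn (fun w => (w - z)⁻¹) K := ContinuousOn.inv₀ (by fun_prop) hne
      have hc2 : ContinuousOn (fun w => F w / (w - z)) K := hFK.div (by fun_prop) hne
      simp only [hH, if_pos hzU]
      have e : ∀ x, dslope F (ζ x) z * ρ x
          = F (ζ x) / (ζ x - z) * ρ x - F z * ((ζ x - z)⁻¹ * ρ x) := fun x => by
        have h1 := hne _ (hmem x)
        have h2 : z - ζ x ≠ 0 := fun h => h1 (by rw [← neg_sub, h, neg_zero])
        rw [dslope_of_ne _ (sub_ne_zero.1 h2), slope_def_field, ← neg_sub (ζ x) z, div_neg]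
        field_simp
        ring
      simp_rw [e]
      rw [integral_sub (integrable_comp_mul hρ hζ hmem hK hc2)
        ((integrable_comp_mul hρ hζ hmem hK hc1).const_mul _), integral_const_mul, hi]
      simp
    · simp only [hH, if_neg hzU]
  have hdiff : Differentiable ℂ H := by
    intro z₀
    by_cases hz₀ : z₀ ∈ U
    · obtain ⟨r, hr, hrU, M, hM⟩ := exists_bound_dslope hK hU hKU hF hz₀
      have hd := differentiableAt_integral_of_bounded_family hρ (G := fun z x => dslope F (ζ x) z)
        hr (fun z hz => ?_) (fun x => ?_) (fun z hz x => hM z hz _ (hmem x))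
      · refine hd.congr_of_eventuallyEq ?_
        filter_upwards [ball_mem_nhds z₀ hr] with z hz
        simp only [hH, if_pos (hrU hz)]
      · refine (measurable_comp_of_continuousOn (f := fun w => dslope F w z) (K := K) ?_ hζ
          hmem).aestronglyMeasurable
        simp_rw [dslope_symm F _ z]
        exact ((continuousOn_dslope (hU.mem_nhds (hrU hz))).2
          ⟨hF.continuousOn, hF.differentiableAt (hU.mem_nhds (hrU hz))⟩).mono hKU
      · exact ((Complex.differentiableOn_dslope (hU.mem_nhds (hKU (hmem x)))).2 hF).mono hrU
    · have hzK : z₀ ∉ K := fun h => hz₀ (hKU h)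
      obtain ⟨r, hr, hball⟩ := Metric.isOpen_iff.1 hK.isClosed.isOpen_compl z₀ hzK
      refine (differentiableAt_cauchyTransform hρ hζ hmem hK hFK hzK).congr_of_eventuallyEq ?_
      filter_upwards [ball_mem_nhds z₀ hr] with z hz
      refine key z (hball hz) ?_
      rw [integral_inv_sub_eq_of_near hρ hζ hmem hK hclosed (z₀ := z₀), hind z₀ hz₀]
      intro w hw
      by_contra! h
      exact hball (mem_ball.2 (by
        rw [dist_eq_norm]; exact h.trans_lt (by simpa [dist_eq_norm] using hz))) hw
  have hlim : Tendsto H (cocompact ℂ) (𝓝 0) := by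
    obtain ⟨R, hR⟩ := hK.isBounded.exists_norm_le
    obtain ⟨B, hB⟩ := hK.exists_bound_of_continuousOn hFK
    have hev : ∀ᶠ z in cocompact ℂ, ‖H z‖ ≤ (∫ x, B * ‖ρ x‖ ∂μ) / (‖z‖ - R) := by
      filter_upwards [tendsto_norm_cocompact_atTop.eventually_gt_atTop R] with z hz
      have hfar : ∀ w ∈ K, ‖w‖ < ‖z‖ := fun w hw => (hR w hw).trans_lt hz
      rw [key z (fun h => lt_irrefl _ (hfar z h)) (integral_inv_sub_eq_zero_of_far hclosed hfar),
        ← integral_div]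
      refine norm_integral_le_of_norm_le ((hρ.norm.const_mul B).div_const _)
        (Eventually.of_forall fun x => ?_)
      rw [norm_mul, norm_div, mul_div_right_comm]
      refine mul_le_mul_of_nonneg_right ?_ (norm_nonneg _)
      refine div_le_div₀ ((norm_nonneg _).trans (hB _ (hmem x))) (hB _ (hmem x)) (by linarith) ?_
      have := norm_sub_norm_le z (ζ x)
      rw [norm_sub_rev] at this
      linarith [hR _ (hmem x)]
    refine squeeze_zero_norm' hev ?_
    exact Tendsto.div_atTop tendsto_const_nhds
      (tendsto_atTop_add_const_right _ (-R) tendsto_norm_cocompact_atTop)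
  -- Liouville: H is entire and tends to 0 at infinity, so H(0) = 0.
  have h0 := hdiff.apply_eq_of_tendsto_cocompact 0 hlim
  simp only [hH, if_neg h0U] at h0
  rw [← h0]
  refine integral_congr_ae (Eventually.of_forall fun x => ?_)
  have : ζ x ≠ 0 := fun h => h0U (h ▸ hKU (hmem x))
  simp [hFdef, this]

end Dixon

end

section

open MeasureTheory Filter Set Metric

/-! ### Regular points -/

/-- The value at `p` of the holomorphic extension of `f` to its regular points. -/
def regularization (f : ℂ → ℂ) (p : ℂ) : ℂ := limUnder (𝓝[≠] p) f

theorem eventually_nhds_eventually_punctured {p : ℂ} {P : ℂ → Prop} (h : ∀ᶠ z in 𝓝[≠] p, P z) :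
    ∀ᶠ y in 𝓝 p, ∀ᶠ z in 𝓝[≠] y, P z := by
  obtain ⟨u, hu, hpu, hsub⟩ := mem_nhdsWithin.1 h
  filter_upwards [hu.mem_nhds hpu] with y hy
  by_cases hyp : y = p
  · rwa [hyp]
  · exact nhdsWithin_le_nhds <| mem_of_superset
      ((hu.inter isOpen_compl_singleton).mem_nhds ⟨hy, hyp⟩) hsub

theorem regularization_eventuallyEq {f g : ℂ → ℂ} {p : ℂ} (hg : AnalyticAt ℂ g p)
    (h : ∀ᶠ z in 𝓝[≠] p, f z = g z) : regularization f =ᶠ[𝓝 p] g := by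
  filter_upwards [eventually_nhds_eventually_punctured h, hg.eventually_analyticAt] with y hy hgy
  exact (hgy.continuousAt.continuousWithinAt.tendsto.congr'
    (hy.mono fun z hz => hz.symm)).limUnder_eq

theorem RegularAt.analyticAt {f : ℂ → ℂ} {p : ℂ} (h : RegularAt f p) :
    AnalyticAt ℂ (regularization f) p := by
  obtain ⟨g, hg, hfg⟩ := h
  exact hg.congr (regularization_eventuallyEq hg hfg).symm

theorem RegularAt.eventually_eq {f : ℂ → ℂ} {p : ℂ} (h : RegularAt f p) :
    ∀ᶠ z in 𝓝[≠] p, f z = regularization f z := by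
  obtain ⟨g, hg, hfg⟩ := h
  filter_upwards [hfg, nhdsWithin_le_nhds (regularization_eventuallyEq hg hfg)] with z h1 h2
  rw [h1, h2]

theorem isOpen_setOf_regularAt (f : ℂ → ℂ) : IsOpen {p | RegularAt f p} := by
  refine isOpen_iff_mem_nhds.2 fun p hp => ?_
  obtain ⟨g, hg, hfg⟩ := hp
  filter_upwards [eventually_nhds_eventually_punctured hfg, hg.eventually_analyticAt] with y hy hgy
  exact ⟨g, hgy, hy⟩

theorem RegularAt.mul {f g : ℂ → ℂ} {p : ℂ} (hf : RegularAt f p) (hg : RegularAt g p) :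
    RegularAt (fun z => f z * g z) p := by
  obtain ⟨f', hf', hff⟩ := hf
  obtain ⟨g', hg', hgg⟩ := hg
  refine ⟨fun z => f' z * g' z, hf'.mul hg', ?_⟩
  filter_upwards [hff, hgg] with z h1 h2
  rw [h1, h2]

theorem _root_.AnalyticAt.regularAt {f : ℂ → ℂ} {p : ℂ} (h : AnalyticAt ℂ f p) : RegularAt f p :=
  ⟨f, h, Eventually.of_forall fun _ => rfl⟩

/-- A property holding in a punctured neighbourhood of every point of a compact set fails at only
finitely many of its points. -/
theorem finite_of_eventually_punctured {K : Set ℂ} (hK : IsCompact K) {P : ℂ → Prop}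
    (h : ∀ p ∈ K, ∀ᶠ z in 𝓝[≠] p, P z) : {z ∈ K | ¬ P z}.Finite := by
  have := hK.finite_sdiff_of_mem_codiscreteWithin (s := {z | P z})
    (mem_codiscreteWithin_iff_forall_mem_nhdsNE.2 fun p hp => by
      filter_upwards [h p hp] with z hz using Or.inl hz)
  exact this

/-! ### Cycles -/

/-- Where the velocity is nonzero the curve leaves p immediately, so such parameters form a discrete
subset of the line. A curve may rest at an exceptional point for a positive time, but then its
velocity vanishes and the integrand does not see it. -/
theorem countable_setOf_deriv_ne_zero (γ : ℝ → ℂ) (p : ℂ) :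
    {s | γ s = p ∧ deriv γ s ≠ 0}.Countable := by
  set A := {s | γ s = p ∧ deriv γ s ≠ 0}
  have hd : IsDiscrete A := isDiscrete_iff_nhdsNE.2 fun s hs => by
    have hda : HasDerivAt γ (deriv γ s) s := by
      by_contra h
      exact hs.2 (deriv_zero_of_not_differentiableAt fun h' => h h'.hasDerivAt)
    have h1 := hda.eventually_ne (c := p) hs.2
    rw [← disjoint_iff, disjoint_principal_right]
    filter_upwards [h1] with y hy hyA
    exact hy hyA.1
  have := hd.to_subtype
  exact Set.countable_coe_iff.1 (countable_of_Lindelof_of_discrete (X := A))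

theorem ae_mem_imp_deriv_eq_zero (γ : ℝ → ℂ) {T : Set ℂ} (hT : T.Countable) :
    ∀ᵐ s, γ s ∈ T → deriv γ s = 0 := by
  have : (⋃ p ∈ T, {s | γ s = p ∧ deriv γ s ≠ 0}).Countable :=
    hT.biUnion fun p _ => countable_setOf_deriv_ne_zero γ p
  filter_upwards [this.ae_notMem volume] with s hs hsT
  by_contra h
  exact hs (mem_biUnion hsT ⟨rfl, h⟩)

/-- Lebesgue measure on the unit interval. -/
abbrev unitMeasure : Measure ℝ := volume.restrict (Icc 0 1)

namespace Cycle

variable (C : Cycle)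

/-- A curve of a cycle, extended continuously to the whole line. -/
def path (c : Fin C.size) (s : ℝ) : ℂ := C.curve c (projIcc 0 1 zero_le_one s)

theorem continuous_path (c : Fin C.size) : Continuous (C.path c) :=
  (continuousOn_iff_continuous_domRestrict.1 (C.continuousOn c)).comp continuous_projIcc

theorem path_mem (c : Fin C.size) (s : ℝ) : C.path c s ∈ C.points :=
  mem_iUnion.2 ⟨c, mem_image_of_mem _ (projIcc 0 1 zero_le_one s).2⟩

theorem path_eq {c : Fin C.size} {s : ℝ} (hs : s ∈ Icc (0 : ℝ) 1) : C.path c s = C.curve c s := by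
  rw [path, projIcc_of_mem _ hs]

theorem isCompact_points : IsCompact C.points :=
  isCompact_iUnion fun c => isCompact_Icc.image_of_continuousOn (C.continuousOn c)

theorem ne_zero_of_mem_points {x : ℂ} (hx : x ∈ C.points) : x ≠ 0 := by
  obtain ⟨c, s, hs, rfl⟩ := mem_iUnion.1 hx
  exact C.ne_zero c s hs

theorem ae_mem_Ioo : ∀ᵐ s ∂unitMeasure, s ∈ Ioo (0 : ℝ) 1 := by
  rw [unitMeasure, ← restrict_Ioo_eq_restrict_Icc]
  exact ae_restrict_mem measurableSet_Ioo

theorem exists_bound_deriv (c : Fin C.size) : ∃ B, ∀ᵐ s ∂unitMeasure, ‖deriv (C.curve c) s‖ ≤ B := by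
  obtain ⟨S, hS, B, hB⟩ := C.piecewiseC1 c
  refine ⟨B, ?_⟩
  filter_upwards [ae_mem_Ioo, ae_restrict_of_ae (hS.countable.ae_notMem volume)] with s h1 h2
  exact (hB s ⟨h1, h2⟩).2

theorem integrable_deriv (c : Fin C.size) : Integrable (deriv (C.curve c)) unitMeasure := by
  obtain ⟨B, hB⟩ := C.exists_bound_deriv c
  exact (integrable_const B).mono' (measurable_deriv _).aestronglyMeasurable hB

theorem integral_eq (f : ℂ → ℂ) :
    C.integral f = ∑ c, ∫ s, f (C.curve c s) * deriv (C.curve c) s ∂unitMeasure := by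
  refine Finset.sum_congr rfl fun c _ => ?_
  rw [intervalIntegral.integral_of_le zero_le_one, ← integral_Icc_eq_integral_Ioc]

theorem integral_eq_path (f : ℂ → ℂ) :
    C.integral f = ∑ c, ∫ s, f (C.path c s) * deriv (C.curve c) s ∂unitMeasure := by
  rw [integral_eq]
  refine Finset.sum_congr rfl fun c _ => setIntegral_congr_fun measurableSet_Icc fun s hs => ?_
  simp only [C.path_eq hs]

theorem integral_congr {f g : ℂ → ℂ} (h : {z ∈ C.points | f z ≠ g z}.Countable) :
    C.integral f = C.integral g := by
  rw [integral_eq, integral_eq]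
  refine Finset.sum_congr rfl fun c _ => integral_congr_ae ?_
  filter_upwards [ae_restrict_of_ae (ae_mem_imp_deriv_eq_zero (C.curve c) h),
    ae_restrict_mem measurableSet_Icc] with s hs hs'
  by_cases hfg : f (C.curve c s) = g (C.curve c s)
  · simp only [hfg]
  · have : C.curve c s ∈ C.points := C.path_eq hs' ▸ C.path_mem c s
    simp only [hs ⟨this, hfg⟩, mul_zero]

/-- Exact forms integrate to zero over a dilated closed curve. -/
theorem integral_deriv_eq_zero (c : Fin C.size) (a : ℂ) {g g' : ℂ → ℂ}
    (hg : ∀ z ∈ C.points, HasDerivAt g (g' (a * z)) (a * z))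
    (hg' : ContinuousOn (fun z => g' (a * z)) C.points) :
    ∫ s, g' (a * C.path c s) * (a * deriv (C.curve c) s) ∂unitMeasure = 0 := by
  obtain ⟨S, hS, B, hB⟩ := C.piecewiseC1 c
  have hint : Integrable (fun s => g' (a * C.path c s) * (a * deriv (C.curve c) s)) unitMeasure := by
    have := (integrable_comp_mul (C.integrable_deriv c) (C.continuous_path c).measurable
      (C.path_mem c) C.isCompact_points hg').const_mul a
    refine this.congr (Eventually.of_forall fun s => ?_)
    ring
  rw [unitMeasure, integral_Icc_eq_integral_Ioc, ← intervalIntegral.integral_of_le zero_le_one,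
    integral_eq_of_hasDerivAt_off_countable_of_le (fun s => g (a * C.path c s)) _ zero_le_one
      hS.countable ?_ ?_ ?_]
  · rw [C.path_eq (by simp), C.path_eq (by simp), C.closed, sub_self]
  · intro s _
    exact ((hg _ (C.path_mem c s)).continuousAt.comp (f := fun s => a * C.path c s)
      (continuous_const.mul (C.continuous_path c)).continuousAt).continuousWithinAt
  · intro s hs
    have hd : HasDerivAt (C.curve c) (deriv (C.curve c) s) s :=
      ((hB s hs).1.differentiableAt (by norm_num)).hasDerivAt
    have hd' : HasDerivAt (C.path c) (deriv (C.curve c) s) s := by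
      refine hd.congr_of_eventuallyEq ?_
      filter_upwards [Ioo_mem_nhds hs.1.1 hs.1.2] with y hy
      exact C.path_eq (Ioo_subset_Icc_self hy)
    exact (hg _ (C.path_mem c s)).comp s (hd'.const_mul a)
  · rw [intervalIntegrable_iff_integrableOn_Icc_of_le zero_le_one]
    exact hint

/-- **Invariance under the `q`-shift.** -/
theorem integral_eq_integral_shift {q : ℂ} (hq : q ≠ 0) {f : ℂ → ℂ}
    (hS : ∀ p, p ≠ 0 → ¬ RegularAt f p →
      p ∉ C.points ∧ p / q ∉ C.points ∧ C.index p = C.index (p / q)) :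
    C.integral f = C.integral fun z => q * f (q * z) := by
  -- The origin can be removed from the domain at no cost: 0/q = 0, so C and qC wind equally often
  -- around it.
  set U : Set ℂ := {p | RegularAt f p} \ {0} with hUdef
  have hU : IsOpen U := (isOpen_setOf_regularAt f).sdiff isClosed_singleton
  set F := regularization f
  have hF : DifferentiableOn ℂ F U := fun z hz =>
    (RegularAt.analyticAt hz.1).differentiableAt.differentiableWithinAt
  have h1U : C.points ⊆ U := fun z hz => by
    have hz0 := C.ne_zero_of_mem_points hz
    refine ⟨by_contra fun h => (hS z hz0 h).1 hz, hz0⟩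
  set K₂ : Set ℂ := (fun z => q * z) '' C.points
  have hK₂ : IsCompact K₂ := C.isCompact_points.image (by fun_prop)
  have h2U : K₂ ⊆ U := by
    rintro _ ⟨z, hz, rfl⟩
    have hz0 := mul_ne_zero hq (C.ne_zero_of_mem_points hz)
    refine ⟨by_contra fun h => (hS _ hz0 h).2.1 ?_, hz0⟩
    rwa [mul_div_cancel_left₀ _ hq]
  have e1 : C.integral f = C.integral F := by
    refine C.integral_congr (finite_of_eventually_punctured C.isCompact_points fun p hp => ?_).countable
    exact (h1U hp).1.eventually_eq
  have e2 : C.integral (fun z => q * f (q * z)) = C.integral fun z => q * F (q * z) := by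
    refine C.integral_congr (Set.Finite.countable ?_)
    have := finite_of_eventually_punctured hK₂ (P := fun z => f z = F z)
      fun p hp => (h2U hp).1.eventually_eq
    refine (this.preimage (mul_right_injective₀ hq).injOn).subset fun z hz => ?_
    exact ⟨mem_image_of_mem _ hz.1, fun h => hz.2 (by simp [h])⟩
  rw [e1, e2, ← sub_eq_zero]
  -- The cycle C - qC as a single measure space: the Boolean selects C or its dilate by q, with
  -- dilation factor `a` and orientation sign `σ`.
  let X := (Bool × Fin C.size) × ℝ
  let μ : Measure X := Measure.count.prod unitMeasure
  let a : Bool → ℂ := fun b => if b then 1 else q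
  let σ : Bool → ℂ := fun b => if b then 1 else -1
  let ζ : X → ℂ := fun x => a x.1.1 * C.path x.1.2 x.2
  let ρ : X → ℂ := fun x => σ x.1.1 * (a x.1.1 * deriv (C.curve x.1.2) x.2)
  let K := C.points ∪ K₂
  have hK : IsCompact K := C.isCompact_points.union hK₂
  have hKU : K ⊆ U := union_subset h1U h2U
  have hmem : ∀ x, ζ x ∈ K := by
    rintro ⟨⟨b, c⟩, s⟩
    cases b
    · exact Or.inr ⟨_, C.path_mem c s, rfl⟩
    · exact Or.inl (by simpa [ζ, a] using C.path_mem c s)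
  have hζ : Measurable ζ := measurable_from_prod_countable_right fun i =>
    (C.continuous_path i.2).measurable.const_mul (a i.1)
  have hρm : Measurable ρ := measurable_from_prod_countable_right fun i =>
    ((measurable_deriv (C.curve i.2)).const_mul (a i.1)).const_mul (σ i.1)
  have hρ : Integrable ρ μ := by
    refine (integrable_prod_iff hρm.aestronglyMeasurable).2 ⟨Eventually.of_forall fun i => ?_, ?_⟩
    · exact ((C.integrable_deriv i.2).const_mul (a i.1)).const_mul (σ i.1)
    · exact Integrable.of_finite
  have hJ : ∀ g : ℂ → ℂ, ContinuousOn g K →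
      ∫ x, g (ζ x) * ρ x ∂μ = C.integral g - C.integral fun z => q * g (q * z) := by
    intro g hg
    rw [integral_prod _ (integrable_comp_mul hρ hζ hmem hK hg), integral_count,
      Fintype.sum_prod_type, Fintype.sum_bool, integral_eq_path, integral_eq_path, sub_eq_add_neg,
      ← Finset.sum_neg_distrib]
    congr 1
    · refine Finset.sum_congr rfl fun c _ => ?_
      simp [ζ, ρ, a, σ]
    · refine Finset.sum_congr rfl fun c _ => ?_
      rw [← integral_neg]
      refine integral_congr_ae (Eventually.of_forall fun s => ?_)
      simp [ζ, ρ, a, σ]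
      ring
  rw [← hJ F (hF.continuousOn.mono hKU)]
  refine integral_eq_zero_of_index_eq_zero hρ hζ hmem hK ?_ hU hKU (fun h => h.2 rfl) ?_ hF
  · intro g g' hg hg'
    rw [integral_prod _ (integrable_comp_mul hρ hζ hmem hK hg'), integral_count]
    refine Finset.sum_eq_zero fun i _ => ?_
    have haK : ∀ z ∈ C.points, a i.1 * z ∈ K := fun z hz => by
      rcases i with ⟨b, c⟩
      cases b
      · exact Or.inr ⟨_, hz, rfl⟩
      · exact Or.inl (by simpa [a] using hz)
    have := C.integral_deriv_eq_zero i.2 (a i.1) (g := g) (g' := g') (fun z hz => hg _ (haK z hz))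
      (hg'.comp (by fun_prop) haK)
    calc _ = ∫ s, σ i.1 * (g' (a i.1 * C.path i.2 s) * (a i.1 * deriv (C.curve i.2) s))
          ∂unitMeasure := integral_congr_ae (Eventually.of_forall fun s => by simp [ζ, ρ]; ring)
      _ = 0 := by rw [integral_const_mul, this, mul_zero]
  · intro p hp
    have hpK : ∀ z ∈ K, z - p ≠ 0 := fun z hz h => hp (sub_eq_zero.1 h ▸ hKU hz)
    rw [hJ (fun z => (z - p)⁻¹) (ContinuousOn.inv₀ (by fun_prop) hpK)]
    -- The winding number of qC around p is that of C around p/q.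
    have e : (fun z => q * (q * z - p)⁻¹) = fun z => (z - p / q)⁻¹ := by
      funext z
      have : q * z - p = q * (z - p / q) := by field_simp
      rw [this, mul_inv, mul_inv_cancel_left₀ hq]
    rw [e, sub_eq_zero]
    by_cases hp0 : p = 0
    · simp [hp0]
    · have := (hS p hp0 fun h => hp ⟨h, hp0⟩).2.2
      have hpi : (2 * (Real.pi : ℂ) * Complex.I)⁻¹ ≠ 0 := by
        simp [Real.pi_ne_zero, Complex.I_ne_zero]
      exact mul_left_cancel₀ hpi this

end Cycle

end

section

open Finset

/-! ### The exponential of a power series without constant term -/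

theorem sum_composition_succ {A : Type*} [AddCommMonoid A] (n : ℕ) (g : List ℕ → A) :
    ∑ κ : Composition (n + 1), g κ.blocks =
      ∑ p ∈ antidiagonal n, ∑ κ : Composition p.2, g ((p.1 + 1) :: κ.blocks) := by
  rw [Finset.sum_sigma']
  symm
  refine Finset.sum_bij (fun x hx => (⟨(x.1.1 + 1) :: x.2.blocks, ?_, ?_⟩ : Composition (n + 1)))
    (fun _ _ => mem_univ _) ?_ ?_ (fun _ _ => rfl)
  · intro i hi
    rcases List.mem_cons.1 hi with rfl | hi
    · omega
    · exact x.2.blocks_pos hi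
  · have := mem_antidiagonal.1 (mem_sigma.1 hx).1
    rw [List.sum_cons, x.2.blocks_sum]
    omega
  · rintro ⟨⟨a, b⟩, κ⟩ h ⟨⟨a', b'⟩, κ'⟩ h' heq
    simp only [Composition.mk.injEq, List.cons.injEq, add_left_inj] at heq
    obtain ⟨rfl, hb⟩ := heq
    have : b = b' := κ.blocks_sum.symm.trans ((congrArg List.sum hb).trans κ'.blocks_sum)
    subst this
    have : κ = κ' := Composition.ext hb
    rw [this]
  · intro κ _
    rcases hκ : κ.blocks with _ | ⟨b, l⟩
    · exact absurd (κ.blocks_eq_nil.1 hκ) (by omega)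
    · have hb : 0 < b := κ.blocks_pos (hκ ▸ List.mem_cons_self)
      have hs : b + l.sum = n + 1 := by rw [← κ.blocks_sum, hκ, List.sum_cons]
      refine ⟨⟨(b - 1, l.sum), ⟨l, fun hi => κ.blocks_pos (hκ ▸ List.mem_cons_of_mem _ hi), rfl⟩⟩,
        mem_sigma.2 ⟨mem_antidiagonal.2 (by simp only; omega), mem_univ _⟩, ?_⟩
      refine Composition.ext ?_
      simp only [hκ, List.cons.injEq, and_true]
      omega

section Exp

variable {A : Type*} [CommRing A]

/-- The power series `∑_{k ≥ 1} a_k y^k`. -/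
def genSeries (a : ℕ+ → A) : PowerSeries A :=
  PowerSeries.mk fun n => if n = 0 then 0 else a n.toPNat'

/-- Expanding a j-fold product chooses one exponent per factor, and these exponents form a
composition of n with j blocks. The induction splits off the first block. -/
theorem coeff_genSeries_pow (a : ℕ+ → A) (j n : ℕ) :
    PowerSeries.coeff n (genSeries a ^ j) =
      ∑ κ : Composition n, if κ.blocks.length = j then (κ.blocks.map fun k => a k.toPNat').prod
        else 0 := by
  induction j generalizing n with
  | zero =>
    rcases n with _ | n
    · have : ∀ κ : Composition 0, κ.blocks = [] := fun κ => κ.blocks_eq_nil.2 rfl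
      simp [this, composition_card]
    · rw [sum_composition_succ n fun l => if l.length = 0 then (l.map fun k => a k.toPNat').prod
        else 0]
      simp [PowerSeries.coeff_one]
  | succ j ih =>
    rw [pow_succ', PowerSeries.coeff_mul]
    rcases n with _ | n
    · have : ∀ κ : Composition 0, κ.blocks = [] := fun κ => κ.blocks_eq_nil.2 rfl
      simp [this, genSeries]
    · rw [sum_composition_succ n fun l => if l.length = j + 1 then
        (l.map fun k => a k.toPNat').prod else 0, Finset.Nat.sum_antidiagonal_succ]
      simp only [genSeries, PowerSeries.coeff_mk, if_true, zero_mul, zero_add, Nat.succ_ne_zero,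
        if_false, List.length_cons, add_left_inj, List.map_cons, List.prod_cons]
      refine Finset.sum_congr rfl fun p _ => ?_
      rw [← genSeries, ih, Finset.mul_sum]
      exact Finset.sum_congr rfl fun κ _ => by rw [mul_ite, mul_zero]

theorem genSeries_add (a b : ℕ+ → A) : genSeries (a + b) = genSeries a + genSeries b := by
  ext n
  by_cases h : n = 0 <;> simp [genSeries, h]

/-- `e` is the solution of `e' = (∑ a_k y^k)' e`, `e(0) = 1`. -/
def IsExpSeries (a : ℕ+ → A) (e : PowerSeries A) : Prop :=
  PowerSeries.constantCoeff e = 1 ∧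
    PowerSeries.derivative A e = PowerSeries.derivative A (genSeries a) * e

theorem IsExpSeries.mul {a b : ℕ+ → A} {e f : PowerSeries A} (he : IsExpSeries a e)
    (hf : IsExpSeries b f) : IsExpSeries (a + b) (e * f) := by
  refine ⟨by rw [map_mul, he.1, hf.1, one_mul], ?_⟩
  rw [Derivation.leibniz, he.2, hf.2, genSeries_add, map_add, smul_eq_mul, smul_eq_mul]
  ring

theorem isExpSeries_zero : IsExpSeries (0 : ℕ+ → A) 1 := by
  have : genSeries (0 : ℕ+ → A) = 0 := by ext n; simp [genSeries]
  exact ⟨map_one _, by rw [this]; simp⟩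

theorem IsExpSeries.prod {ι : Type*} (s : Finset ι) {a : ι → ℕ+ → A} {e : ι → PowerSeries A}
    (h : ∀ i ∈ s, IsExpSeries (a i) (e i)) : IsExpSeries (∑ i ∈ s, a i) (∏ i ∈ s, e i) := by
  classical
  induction s using Finset.induction_on with
  | empty => simpa using isExpSeries_zero
  | insert i s hi ih =>
    rw [Finset.sum_insert hi, Finset.prod_insert hi]
    exact (h i (mem_insert_self _ _)).mul (ih fun j hj => h j (mem_insert_of_mem hj))

variable [Algebra ℂ A]

/-- A composition of n has at most n blocks, so every truncation order K ≥ n gives the same value.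
The freedom in K lets several coefficients share one range of summation. -/
theorem expCoeff_eq_sum (a : ℕ+ → A) {n K : ℕ} (h : n ≤ K) :
    expCoeff a n = ∑ j ∈ range (K + 1), ((j ! : ℂ)⁻¹) • PowerSeries.coeff n (genSeries a ^ j) := by
  simp only [coeff_genSeries_pow, Finset.smul_sum, expCoeff, Nat.cast_nonneg, if_true, Int.toNat_natCast]
  rw [Finset.sum_comm]
  refine Finset.sum_congr rfl fun κ _ => ?_
  have hκ : κ.blocks.length ∈ range (K + 1) := by
    have := κ.length_le
    rw [mem_range, κ.blocks_length]
    omega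
  rw [Finset.sum_eq_single_of_mem _ hκ fun j _ hj => by rw [if_neg (Ne.symm hj), smul_zero], if_pos rfl,
    κ.blocks_length]

/-- The power series `exp (∑_{k ≥ 1} a_k y^k)`. -/
def expSeries (a : ℕ+ → A) : PowerSeries A := PowerSeries.mk fun n => expCoeff a n

/-- Termwise differentiation: (g^{j+1}/(j+1)!)' = g' g^j/j!. -/
theorem isExpSeries_expSeries (a : ℕ+ → A) : IsExpSeries a (expSeries a) := by
  constructor
  · rw [← PowerSeries.coeff_zero_eq_constantCoeff_apply, expSeries, PowerSeries.coeff_mk,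
      expCoeff_eq_sum a le_rfl]
    simp
  · ext n
    have h1 : PowerSeries.coeff n (PowerSeries.derivative A (expSeries a)) =
        ∑ j ∈ range (n + 1 + 1), ((j ! : ℂ)⁻¹) •
          PowerSeries.coeff n (PowerSeries.derivative A (genSeries a ^ j)) := by
      rw [PowerSeries.coeff_derivative, expSeries, PowerSeries.coeff_mk,
        expCoeff_eq_sum a le_rfl, Finset.sum_mul]
      exact Finset.sum_congr rfl fun j _ => by rw [PowerSeries.coeff_derivative, smul_mul_assoc]
    have h2 : ∀ j, ((((j + 1) ! : ℕ) : ℂ)⁻¹) •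
        PowerSeries.coeff n (PowerSeries.derivative A (genSeries a ^ (j + 1))) =
        ((j ! : ℂ)⁻¹) • PowerSeries.coeff n (PowerSeries.derivative A (genSeries a) * genSeries a ^ j) := by
      intro j
      rw [PowerSeries.derivative_pow, Nat.add_sub_cancel]
      have : ((j + 1 : ℕ) : PowerSeries A) * genSeries a ^ j * PowerSeries.derivative A (genSeries a)
          = ((j + 1 : ℕ) : ℂ) • (PowerSeries.derivative A (genSeries a) * genSeries a ^ j) := by
        rw [Algebra.smul_def, map_natCast]; ring
      rw [this, PowerSeries.coeff_smul, smul_smul, Nat.factorial_succ]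
      congr 1
      have h3 : ((j + 1 : ℕ) : ℂ) ≠ 0 := Nat.cast_ne_zero.2 (Nat.succ_ne_zero j)
      have h4 : (j ! : ℂ) ≠ 0 := Nat.cast_ne_zero.2 (Nat.factorial_ne_zero j)
      push_cast at h3 ⊢
      field_simp
    rw [h1, Finset.sum_range_succ']
    simp only [h2]
    simp only [pow_zero, Derivation.map_one_eq_zero, map_zero, smul_zero, add_zero,
      PowerSeries.coeff_mul, Finset.smul_sum]
    rw [Finset.sum_comm]
    refine Finset.sum_congr rfl fun p hp => ?_
    have hp' := mem_antidiagonal.1 hp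
    rw [expSeries, PowerSeries.coeff_mk, expCoeff_eq_sum a (show p.2 ≤ n by omega), Finset.mul_sum]
    exact Finset.sum_congr rfl fun j _ => by rw [mul_smul_comm]

/-- The differential equation expresses n+1 times the coefficient of degree n+1 through lower ones,
and n+1 is invertible in a ℂ-algebra. Exponentials can thus be identified by checking the equation
instead of manipulating compositions. -/
theorem IsExpSeries.unique {a : ℕ+ → A} {e e' : PowerSeries A} (h : IsExpSeries a e)
    (h' : IsExpSeries a e') : e = e' := by
  ext n
  induction n using Nat.strong_induction_on with
  | _ n ih =>
    rcases n with _ | n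
    · rw [PowerSeries.coeff_zero_eq_constantCoeff_apply, PowerSeries.coeff_zero_eq_constantCoeff_apply,
        h.1, h'.1]
    · have hu : IsUnit ((n : A) + 1) := by
        have := (IsUnit.mk0 ((n + 1 : ℕ) : ℂ) (Nat.cast_ne_zero.2 n.succ_ne_zero)).map
          (algebraMap ℂ A)
        simpa using this
      refine hu.mul_right_cancel ?_
      rw [← PowerSeries.coeff_derivative, ← PowerSeries.coeff_derivative, h.2, h'.2,
        PowerSeries.coeff_mul, PowerSeries.coeff_mul]
      refine Finset.sum_congr rfl fun p hp => ?_
      have hp' := mem_antidiagonal.1 hp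
      rw [ih p.2 (by omega)]

theorem expCoeff_eq_coeff {a : ℕ+ → A} {e : PowerSeries A} (h : IsExpSeries a e) (n : ℕ) :
    expCoeff a n = PowerSeries.coeff n e := by
  rw [← (isExpSeries_expSeries a).unique h, expSeries, PowerSeries.coeff_mk]

end Exp

theorem expCoeff_of_neg {A : Type*} [Ring A] [Algebra ℂ A] (a : ℕ+ → A) {n : ℤ} (h : n < 0) :
    expCoeff a n = 0 := if_neg (not_le.2 h)

theorem geometric_mul_one_sub (x : ℂ) :
    PowerSeries.mk (fun n => x ^ n) * (1 - PowerSeries.C x * PowerSeries.X) = 1 := by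
  ext n
  rw [mul_sub, mul_one, ← mul_assoc, map_sub]
  rcases n with _ | n
  · simp
  · rw [PowerSeries.coeff_succ_mul_X, mul_comm, PowerSeries.coeff_C_mul]
    simp [PowerSeries.coeff_one, pow_succ']

theorem derivative_genSeries_pow_div (c x : ℂ) :
    PowerSeries.derivative ℂ (genSeries fun k : ℕ+ => c * (x ^ (k : ℕ) / (k : ℕ))) =
      PowerSeries.C (c * x) * PowerSeries.mk fun n => x ^ n := by
  ext n
  rw [PowerSeries.coeff_derivative, PowerSeries.coeff_C_mul, genSeries, PowerSeries.coeff_mk,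
    PowerSeries.coeff_mk, if_neg n.succ_ne_zero]
  have : (n : ℂ) + 1 ≠ 0 := by exact_mod_cast n.succ_ne_zero
  simp only [Nat.toPNat'_coe, Nat.succ_pos, if_true, Nat.cast_add, Nat.cast_one]
  field_simp
  ring

/-- This is exp(log(1 - xy)) = 1 - xy; the companion for the geometric series is exp(-log(1 - xy)).
-/
theorem isExpSeries_one_sub (x : ℂ) :
    IsExpSeries (fun k : ℕ+ => (-1) * (x ^ (k : ℕ) / (k : ℕ)))
      (1 - PowerSeries.C x * PowerSeries.X) := by
  refine ⟨by simp, ?_⟩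
  rw [derivative_genSeries_pow_div, mul_assoc, geometric_mul_one_sub]
  simp

theorem isExpSeries_geometric (x : ℂ) :
    IsExpSeries (fun k : ℕ+ => 1 * (x ^ (k : ℕ) / (k : ℕ))) (PowerSeries.mk fun n => x ^ n) := by
  refine ⟨by simp [← PowerSeries.coeff_zero_eq_constantCoeff_apply], ?_⟩
  rw [derivative_genSeries_pow_div, one_mul]
  set g : PowerSeries ℂ := PowerSeries.mk fun n => x ^ n
  have hg : g * (1 - PowerSeries.C x * PowerSeries.X) = 1 := geometric_mul_one_sub x
  have h := congrArg (PowerSeries.derivative ℂ) hg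
  simp only [Derivation.leibniz, map_sub, Derivation.map_one_eq_zero, smul_eq_mul,
    PowerSeries.derivative_X, PowerSeries.derivative_C] at h
  linear_combination (PowerSeries.derivative ℂ g) * (-hg) + g * h

/-- The factor `∏_{j ≠ i} (c z - x_j)/(z - x_j)` of the `q`-difference operators. -/
def shiftFactor {N : ℕ} (c : ℂ) (x : Fin N → ℂ) (i : Fin N) (z : ℂ) : ℂ :=
  ∏ j ∈ univ.erase i, (c * z - x j) / (z - x j)

/-! ### Partial fractions of ∏ (1 - c x_j y)/(1 - x_j y) -/

section PartialFractions

open Polynomial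

theorem natDegree_one_sub_C_mul_X_le (a : ℂ) : (1 - C a * X : ℂ[X]).natDegree ≤ 1 := by
  compute_degree

theorem natDegree_prod_one_sub_le {ι : Type*} (s : Finset ι) (a : ι → ℂ) :
    (∏ j ∈ s, (1 - C (a j) * X : ℂ[X])).natDegree ≤ #s := by
  refine (natDegree_prod_le _ _).trans ?_
  refine (Finset.sum_le_card_nsmul _ _ 1 fun j _ => natDegree_one_sub_C_mul_X_le _).trans ?_
  simp

theorem coeff_prod_one_sub {N : ℕ} (a : Fin N → ℂ) :
    (∏ j, (1 - C (a j) * X : ℂ[X])).coeff N = ∏ j, -a j := by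
  have := coeff_prod_of_natDegree_le (fun j => (1 - C (a j) * X : ℂ[X])) 1 (s := univ)
    fun j _ => natDegree_one_sub_C_mul_X_le _
  rw [card_univ, Fintype.card_fin, mul_one] at this
  rw [this]
  exact Finset.prod_congr rfl fun j _ => by simp [coeff_one]

/-- Partial fractions, with denominators cleared. -/
theorem prod_sub_prod_eq_sum {N : ℕ} {c : ℂ} (hc : c ≠ 0) {x : Fin N → ℂ}
    (hx : Function.Injective x) (hx0 : ∀ i, x i ≠ 0) :
    (∏ j, (1 - C (x j) * X)) - C ((c ^ N)⁻¹) * ∏ j, (1 - C (c * x j) * X) =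
      ∑ i, C ((1 - c⁻¹) * shiftFactor c⁻¹ x i (x i)) * ∏ j ∈ univ.erase i, (1 - C (x j) * X) := by
  -- Both sides have degree below N, the factor c⁻ᴺ being exactly what cancels the leading terms on
  -- the left. It remains to compare values at the N distinct points 1/x_i, where only one summand
  -- on the right survives.
  refine Polynomial.eq_of_degrees_lt_of_eval_index_eq (s := univ) (v := fun i => (x i)⁻¹)
    (fun i _ j _ h => hx (inv_injective h)) ?_ ?_ fun i _ => ?_
  · rw [card_univ, Fintype.card_fin, degree_lt_iff_coeff_zero]
    intro m hm
    rw [coeff_sub, coeff_C_mul]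
    rcases hm.eq_or_lt with rfl | hm
    · rw [coeff_prod_one_sub, coeff_prod_one_sub]
      simp_rw [← mul_neg]
      rw [Finset.prod_mul_distrib, Finset.prod_const, card_univ, Fintype.card_fin,
        inv_mul_cancel_left₀ (pow_ne_zero _ hc), sub_self]
    · have h : ∀ a : Fin N → ℂ, (∏ j, (1 - C (a j) * X : ℂ[X])).coeff m = 0 := fun a =>
        coeff_eq_zero_of_natDegree_lt ((natDegree_prod_one_sub_le _ _).trans_lt (by simpa using hm))
      rw [h, h, mul_zero, sub_zero]
  · rw [card_univ, Fintype.card_fin, degree_lt_iff_coeff_zero]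
    intro m hm
    rw [finsetSum_coeff]
    refine Finset.sum_eq_zero fun i _ => ?_
    rw [coeff_C_mul, coeff_eq_zero_of_natDegree_lt, mul_zero]
    refine (natDegree_prod_one_sub_le _ _).trans_lt ?_
    rw [card_erase_of_mem (mem_univ _), card_univ, Fintype.card_fin]
    have := i.pos
    omega
  · simp only [eval_sub, eval_mul, eval_C, eval_prod, eval_one, eval_X, eval_finsetSum]
    rw [Finset.prod_eq_zero (mem_univ i) (by rw [mul_inv_cancel₀ (hx0 i), sub_self]),
      Finset.sum_eq_single i (fun k _ hk => by
        rw [Finset.prod_eq_zero (mem_erase.2 ⟨Ne.symm hk, mem_univ i⟩)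
          (by rw [mul_inv_cancel₀ (hx0 i), sub_self]), mul_zero])
        (fun h => absurd (mem_univ i) h), zero_sub]
    have e : (c ^ N)⁻¹ = ∏ _j : Fin N, c⁻¹ := by simp
    rw [e, ← Finset.prod_mul_distrib, ← mul_prod_erase univ _ (mem_univ i), shiftFactor,
      mul_assoc (1 - c⁻¹), ← Finset.prod_mul_distrib]
    have e' : ∏ j ∈ univ.erase i, (c⁻¹ * x i - x j) / (x i - x j) * (1 - x j * (x i)⁻¹) =
        ∏ j ∈ univ.erase i, c⁻¹ * (1 - c * x j * (x i)⁻¹) := by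
      refine Finset.prod_congr rfl fun j hj => ?_
      have : x i - x j ≠ 0 := sub_ne_zero.2 fun h => (mem_erase.1 hj).1 (hx h).symm
      have := hx0 i
      field_simp
    rw [e']
    have := hx0 i
    field_simp
    ring

end PartialFractions

/-- The coefficients of `1 - c^{-N} ∏_i (1 - c x_i y)/(1 - x_i y)`. -/
theorem expCoeff_powerSum {N : ℕ} {c : ℂ} (hc : c ≠ 0) {x : Fin N → ℂ}
    (hx : Function.Injective x) (hx0 : ∀ i, x i ≠ 0) (n : ℕ) :
    (if n = 0 then 1 else 0) - (c ^ N)⁻¹ *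
        expCoeff (fun k : ℕ+ => (1 - c ^ (k : ℕ)) / ((k : ℕ) : ℂ) * ∑ i, x i ^ (k : ℕ)) n =
      (1 - c⁻¹) * ∑ i, shiftFactor c⁻¹ x i (x i) * x i ^ n := by
  set u : ℂ → PowerSeries ℂ := fun a => 1 - PowerSeries.C a * PowerSeries.X with hu
  set g : ℂ → PowerSeries ℂ := fun a => PowerSeries.mk fun n => a ^ n with hg
  have hgu : ∀ a, g a * u a = 1 := geometric_mul_one_sub
  have h1 : IsExpSeries (fun k : ℕ+ => (1 - c ^ (k : ℕ)) / ((k : ℕ) : ℂ) * ∑ i, x i ^ (k : ℕ))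
      (∏ i, (g (x i) * u (c * x i))) := by
    have := IsExpSeries.prod univ fun i _ =>
      (isExpSeries_geometric (x i)).mul (isExpSeries_one_sub (c * x i))
    convert this using 1
    funext k
    rw [Finset.sum_apply, Finset.mul_sum]
    refine Finset.sum_congr rfl fun i _ => ?_
    simp only [Pi.add_apply, mul_pow]
    ring
  -- Multiplying by ∏ 1/(1 - x_i y) restores the denominators and leaves one geometric series per
  -- pole.
  have h2 := congrArg (fun p : Polynomial ℂ => (∏ i, g (x i)) * (p : PowerSeries ℂ))
    (prod_sub_prod_eq_sum hc hx hx0)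
  have hcoe : ∀ (s : Finset (Fin N)) (a : Fin N → ℂ),
      ((∏ j ∈ s, (1 - Polynomial.C (a j) * Polynomial.X) : Polynomial ℂ) : PowerSeries ℂ) =
        ∏ j ∈ s, u (a j) := fun s a => by
    rw [← Polynomial.coeToPowerSeries.ringHom_apply, map_prod]
    simp [hu]
  have hsum : ((∑ i, Polynomial.C ((1 - c⁻¹) * shiftFactor c⁻¹ x i (x i)) *
      ∏ j ∈ univ.erase i, (1 - Polynomial.C (x j) * Polynomial.X) : Polynomial ℂ) : PowerSeries ℂ) =
      ∑ i, PowerSeries.C ((1 - c⁻¹) * shiftFactor c⁻¹ x i (x i)) * ∏ j ∈ univ.erase i, u (x j) := by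
    rw [← Polynomial.coeToPowerSeries.ringHom_apply, map_sum]
    refine Finset.sum_congr rfl fun i _ => ?_
    rw [map_mul, Polynomial.coeToPowerSeries.ringHom_apply,
      Polynomial.coeToPowerSeries.ringHom_apply, hcoe, Polynomial.coe_C]
  simp only [Polynomial.coe_sub, Polynomial.coe_mul, Polynomial.coe_C, hcoe, hsum] at h2
  rw [mul_sub, ← Finset.prod_mul_distrib, Finset.prod_congr rfl fun i _ => hgu (x i),
    Finset.prod_const_one, mul_left_comm, ← Finset.prod_mul_distrib, Finset.mul_sum] at h2
  have h3 := congrArg (PowerSeries.coeff n) h2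
  rw [map_sub, PowerSeries.coeff_one, PowerSeries.coeff_C_mul, ← expCoeff_eq_coeff h1, map_sum] at h3
  rw [h3, Finset.mul_sum]
  refine Finset.sum_congr rfl fun i _ => ?_
  have : (∏ j, g (x j)) * ∏ j ∈ univ.erase i, u (x j) = g (x i) := by
    rw [← mul_prod_erase univ _ (mem_univ i), mul_assoc, ← Finset.prod_mul_distrib,
      Finset.prod_congr rfl fun i _ => hgu (x i), Finset.prod_const_one, mul_one]
  rw [mul_left_comm, this, PowerSeries.coeff_C_mul, hg, PowerSeries.coeff_mk, mul_assoc]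

theorem expCoeff_one (a : ℕ+ → ℂ) : expCoeff a 1 = a 1 := by
  have h := expCoeff_eq_sum a (le_refl 1)
  have h1 : Nat.toPNat' 1 = 1 := rfl
  simpa [Finset.sum_range_succ, genSeries, h1] using h

/-- Take the coefficient n = 1 in `expCoeff_powerSum` at the inverted points 1/x_i: inversion turns
the shift factors for c⁻¹ into those for c, up to c^{1-N}. This evaluates the sum over poles at the
exponent -1, needed for the mode m = -1. -/
theorem sum_shiftFactor_div {N : ℕ} {c : ℂ} (hc : c ≠ 0) {x : Fin N → ℂ}
    (hx : Function.Injective x) (hx0 : ∀ i, x i ≠ 0) :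
    (1 - c) * ∑ i, shiftFactor c x i (x i) * (x i)⁻¹ = (1 - c) * ∑ i, (x i)⁻¹ := by
  have h := expCoeff_powerSum hc (x := fun i => (x i)⁻¹) (fun i j h => hx (inv_injective h))
    (fun i => inv_ne_zero (hx0 i)) 1
  rw [Nat.cast_one, expCoeff_one] at h
  have e : ∀ i, shiftFactor c⁻¹ (fun i => (x i)⁻¹) i (x i)⁻¹ =
      c * (c ^ N)⁻¹ * shiftFactor c x i (x i) := fun i => by
    have e1 : c * (c ^ N)⁻¹ = ∏ _j ∈ univ.erase i, c⁻¹ := by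
      rw [Finset.prod_const, card_erase_of_mem (mem_univ _), card_univ, Fintype.card_fin, inv_pow]
      have : N = (N - 1) + 1 := by have := i.pos; omega
      generalize N - 1 = M at this
      subst this
      field_simp
      ring
    rw [e1, shiftFactor, shiftFactor, ← Finset.prod_mul_distrib]
    refine Finset.prod_congr rfl fun j hj => ?_
    have h1 : x i - x j ≠ 0 := sub_ne_zero.2 fun h => (mem_erase.1 hj).1 (hx h).symm
    have h2 : x j - x i ≠ 0 := sub_ne_zero.2 fun h => (mem_erase.1 hj).1 (hx h)
    have h3 : (x i)⁻¹ - (x j)⁻¹ ≠ 0 := sub_ne_zero.2 fun h => h1 (by rw [inv_injective h, sub_self])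
    have := hx0 i
    have := hx0 j
    rw [← mul_div_assoc, div_eq_div_iff h3 h1]
    field_simp
    ring
  simp only [e, pow_one, one_ne_zero, if_false, zero_sub, mul_assoc, ← Finset.mul_sum] at h
  have hcN := pow_ne_zero N hc
  simp only [PNat.one_coe, pow_one, Nat.cast_one, div_one] at h
  generalize ∑ i, (x i)⁻¹ = S at h ⊢
  generalize ∑ i, shiftFactor c x i (x i) * (x i)⁻¹ = T at h ⊢
  field_simp at h
  linear_combination h

end

section

open Finset

/-! ### Exponentials of linear forms in the times -/

/-- The formal power series `exp (∑_k c_k p_k)`. -/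
def expLinear (c : ℕ+ → ℂ) : MvPowerSeries ℕ+ ℂ := fun μ => expLinearCoeff c μ

theorem coeff_expLinear (c : ℕ+ → ℂ) (μ : ℕ+ →₀ ℕ) :
    MvPowerSeries.coeff μ (expLinear c) = expLinearCoeff c μ := rfl

theorem expLinearCoeff_zero (c : ℕ+ → ℂ) : expLinearCoeff c 0 = 1 := Finsupp.prod_zero_index

theorem expLinearCoeff_add_single (c : ℕ+ → ℂ) (μ : ℕ+ →₀ ℕ) (k : ℕ+) :
    expLinearCoeff c (μ + Finsupp.single k 1) * (μ k + 1) = c k * expLinearCoeff c μ := by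
  classical
  set s := insert k μ.support with hs
  have hk : k ∈ s := mem_insert_self _ _
  have h1 : ∀ ν : ℕ+ →₀ ℕ, ν.support ⊆ s → expLinearCoeff c ν =
      c k ^ ν k / ((ν k)! : ℂ) * ∏ j ∈ s.erase k, c j ^ ν j / ((ν j)! : ℂ) := fun ν hν => by
    rw [expLinearCoeff, Finsupp.prod_of_support_subset _ hν _ (by simp), mul_prod_erase s
      (fun j => c j ^ ν j / ((ν j)! : ℂ)) hk]
  rw [h1 μ (subset_insert _ _), h1 (μ + Finsupp.single k 1)]
  · have e : ∏ j ∈ s.erase k, c j ^ ((μ + Finsupp.single k 1 : ℕ+ →₀ ℕ) j) /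
        (((μ + Finsupp.single k 1 : ℕ+ →₀ ℕ) j)! : ℂ) =
        ∏ j ∈ s.erase k, c j ^ μ j / ((μ j)! : ℂ) := Finset.prod_congr rfl fun j hj => by
      rw [Finsupp.add_apply, Finsupp.single_eq_of_ne (mem_erase.1 hj).1, add_zero]
    rw [e, Finsupp.add_apply, Finsupp.single_eq_same, Nat.factorial_succ, pow_succ]
    have h2 : ((μ k)! : ℂ) ≠ 0 := Nat.cast_ne_zero.2 (Nat.factorial_ne_zero _)
    have h3 : (μ k : ℂ) + 1 ≠ 0 := by exact_mod_cast (μ k).succ_ne_zero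
    push_cast
    field_simp
  · refine Finsupp.support_add.trans (union_subset (subset_insert _ _) ?_)
    exact Finsupp.support_single_subset.trans (by simp [hs])

theorem dp_expLinear (c : ℕ+ → ℂ) (k : ℕ+) : dp k (expLinear c) = c k • expLinear c := by
  ext μ
  change MvPowerSeries.coeff μ (MvPowerSeries.pderiv ℂ k (expLinear c)) = _
  rw [MvPowerSeries.coeff_pderiv, coeff_expLinear, expLinearCoeff_add_single]
  rfl

/-- The eigenvalue equations determine each coefficient from one of total degree one less, so the
constant term fixes the whole series. -/
theorem eq_expLinear {c : ℕ+ → ℂ} {F : MvPowerSeries ℕ+ ℂ}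
    (h0 : MvPowerSeries.coeff 0 F = 1) (h : ∀ k, dp k F = c k • F) : F = expLinear c := by
  have key : ∀ (n : ℕ) (μ : ℕ+ →₀ ℕ), μ.degree = n →
      MvPowerSeries.coeff μ F = expLinearCoeff c μ := by
    intro n
    induction n with
    | zero =>
      intro μ hμ
      rw [(Finsupp.degree_eq_zero_iff μ).1 hμ, h0, expLinearCoeff_zero]
    | succ n ih =>
      intro μ hμ
      obtain ⟨k, hk⟩ : ∃ k, μ k ≠ 0 := by
        by_contra! h'
        have : μ = 0 := Finsupp.ext h'
        simp [this] at hμ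
      obtain ⟨ν, rfl⟩ : ∃ ν, μ = ν + Finsupp.single k 1 :=
        ⟨μ - Finsupp.single k 1, (tsub_add_cancel_of_le (Finsupp.single_le_iff.2
          (Nat.one_le_iff_ne_zero.2 hk))).symm⟩
      rw [map_add, Finsupp.degree_single, add_left_inj] at hμ
      have h3 : (ν k : ℂ) + 1 ≠ 0 := by exact_mod_cast (ν k).succ_ne_zero
      refine mul_right_cancel₀ h3 ?_
      rw [expLinearCoeff_add_single, ← ih ν hμ, ← MvPowerSeries.coeff_pderiv]
      exact congrArg (MvPowerSeries.coeff ν) (h k)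
  ext μ
  exact key _ μ rfl

theorem expLinear_mul (c d : ℕ+ → ℂ) : expLinear c * expLinear d = expLinear (c + d) := by
  refine eq_expLinear ?_ fun k => ?_
  · rw [MvPowerSeries.coeff_zero_eq_constantCoeff_apply, map_mul,
      ← MvPowerSeries.coeff_zero_eq_constantCoeff_apply,
      ← MvPowerSeries.coeff_zero_eq_constantCoeff_apply, coeff_expLinear, coeff_expLinear,
      expLinearCoeff_zero, expLinearCoeff_zero, one_mul]
  · change MvPowerSeries.pderiv ℂ k _ = _
    have h1 : MvPowerSeries.pderiv ℂ k (expLinear c) = c k • expLinear c := dp_expLinear c k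
    have h2 : MvPowerSeries.pderiv ℂ k (expLinear d) = d k • expLinear d := dp_expLinear d k
    rw [Derivation.leibniz, h1, h2, Pi.add_apply, add_smul, smul_eq_mul, smul_eq_mul,
      mul_smul_comm, mul_smul_comm, mul_comm (expLinear d), add_comm]

/-- On a common eigenvector each word in the operators acts by the product of the eigenvalues. No
commutativity of the operators is needed. -/
theorem expCoeff_apply_of_eigenvector {V : Type*} [AddCommGroup V] [Module ℂ V]
    {T : ℕ+ → Module.End ℂ V} {ev : ℕ+ → ℂ} {F : V} (h : ∀ k, T k F = ev k • F) (n : ℤ) :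
    expCoeff T n F = expCoeff ev n • F := by
  unfold expCoeff
  split_ifs
  · rw [LinearMap.sum_apply, Finset.sum_smul]
    refine Finset.sum_congr rfl fun κ _ => ?_
    rw [LinearMap.smul_apply, smul_assoc]
    congr 1
    induction κ.blocks with
    | nil => simp
    | cons b l ih =>
      rw [List.map_cons, List.prod_cons, Module.End.mul_apply, ih, map_smul, h, smul_smul,
        List.map_cons, List.prod_cons, mul_comm]
  · simp

/-- The weighted degree `∑ k μ_k` of a monomial in the times. -/
abbrev timesWeight : (ℕ+ →₀ ℕ) →+ ℕ := Finsupp.weight fun k : ℕ+ => (k : ℕ)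

/-- The part of weighted degree `n` of `exp (∑_k c_k p_k)`. -/
def expLinearPart (c : ℕ+ → ℂ) (n : ℕ) : MvPowerSeries ℕ+ ℂ :=
  fun μ => if timesWeight μ = n then expLinearCoeff c μ else 0

theorem coeff_expLinearPart (c : ℕ+ → ℂ) (n : ℕ) (μ : ℕ+ →₀ ℕ) :
    MvPowerSeries.coeff μ (expLinearPart c n) =
      if timesWeight μ = n then expLinearCoeff c μ else 0 := rfl

/-- c_k p_k exp = p_k ∂_k exp, and p_k ∂_k multiplies the monomial by μ_k; multiplication by p_k
raises the weight by k. -/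
theorem coeff_X_mul_expLinearPart (c : ℕ+ → ℂ) (k : ℕ+) (n : ℕ) (μ : ℕ+ →₀ ℕ) :
    MvPowerSeries.coeff μ ((c k • MvPowerSeries.X k) * expLinearPart c n) =
      if timesWeight μ = n + k then expLinearCoeff c μ * μ k else 0 := by
  classical
  rw [smul_mul_assoc, MvPowerSeries.coeff_smul, MvPowerSeries.X, MvPowerSeries.coeff_monomial_mul]
  by_cases hk : μ k = 0
  · rw [if_neg (by simp [Finsupp.single_le_iff, hk])]
    simp [hk]
  · have hle : Finsupp.single k 1 ≤ μ := Finsupp.single_le_iff.2 (Nat.one_le_iff_ne_zero.2 hk)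
    obtain ⟨ν, rfl⟩ : ∃ ν, μ = ν + Finsupp.single k 1 :=
      ⟨μ - Finsupp.single k 1, (tsub_add_cancel_of_le hle).symm⟩
    have hiff : timesWeight (ν + Finsupp.single k 1) = n + k ↔ timesWeight ν = n := by
      rw [map_add, Finsupp.weight_single, smul_eq_mul, one_mul]
      omega
    rw [if_pos hle, add_tsub_cancel_right, coeff_expLinearPart]
    by_cases hν : timesWeight ν = n
    · rw [if_pos hν, if_pos (hiff.2 hν), one_mul, ← expLinearCoeff_add_single]
      simp
    · rw [if_neg hν, if_neg (mt hiff.1 hν), mul_zero, mul_zero]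

/-- Substituting y^k p_k for p_k grades the exponential by weight. The differential equation in y is
then Euler's identity: ∑ k μ_k is the weight of the monomial. -/
theorem isExpSeries_expLinearPart (c : ℕ+ → ℂ) :
    IsExpSeries (fun k => c k • (MvPowerSeries.X k : MvPowerSeries ℕ+ ℂ))
      (PowerSeries.mk (expLinearPart c)) := by
  classical
  constructor
  · rw [← PowerSeries.coeff_zero_eq_constantCoeff_apply, PowerSeries.coeff_mk]
    ext μ
    rw [coeff_expLinearPart, MvPowerSeries.coeff_one]
    have : timesWeight μ = 0 ↔ μ = 0 := by
      refine ⟨fun h => ?_, fun h => by rw [h, map_zero]⟩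
      rw [timesWeight, Finsupp.weight_apply, Finsupp.sum, Finset.sum_eq_zero_iff] at h
      ext k
      by_contra hk
      have := h k (Finsupp.mem_support_iff.2 hk)
      simp only [smul_eq_mul, mul_eq_zero, k.ne_zero, or_false] at this
      exact hk this
    by_cases hμ : μ = 0
    · rw [if_pos (this.2 hμ), if_pos hμ, hμ, expLinearCoeff_zero]
    · rw [if_neg (mt this.1 hμ), if_neg hμ]
  · ext n : 1
    rw [PowerSeries.coeff_derivative, PowerSeries.coeff_mk, PowerSeries.coeff_mul]
    ext μ
    have h1 : ∀ p ∈ antidiagonal n, MvPowerSeries.coeff μ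
        (PowerSeries.coeff p.1 (PowerSeries.derivative _ (genSeries fun k =>
          c k • (MvPowerSeries.X k : MvPowerSeries ℕ+ ℂ))) *
          PowerSeries.coeff p.2 (PowerSeries.mk (expLinearPart c))) =
        if timesWeight μ = n + 1 then
          expLinearCoeff c μ * (μ p.1.succPNat * (p.1 + 1) : ℕ) else 0 := by
      intro p hp
      have hp' := mem_antidiagonal.1 hp
      have e : PowerSeries.coeff p.1 (PowerSeries.derivative _ (genSeries fun k =>
          c k • (MvPowerSeries.X k : MvPowerSeries ℕ+ ℂ))) =
          ((p.1 + 1 : ℕ) : ℂ) • c p.1.succPNat • MvPowerSeries.X p.1.succPNat := by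
        rw [PowerSeries.coeff_derivative, genSeries, PowerSeries.coeff_mk, if_neg (Nat.succ_ne_zero _),
          Algebra.smul_def ((p.1 + 1 : ℕ) : ℂ), map_natCast, mul_comm]
        push_cast
        rfl
      rw [e, PowerSeries.coeff_mk, smul_mul_assoc, MvPowerSeries.coeff_smul,
        coeff_X_mul_expLinearPart, Nat.succPNat_coe, show p.2 + p.1.succ = n + 1 by omega]
      split_ifs
      · push_cast
        ring
      · rw [mul_zero]
    rw [map_sum, Finset.sum_congr rfl h1]
    have h2 : MvPowerSeries.coeff μ (expLinearPart c (n + 1) * ((n : MvPowerSeries ℕ+ ℂ) + 1)) =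
        ((n : ℂ) + 1) * MvPowerSeries.coeff μ (expLinearPart c (n + 1)) := by
      have : expLinearPart c (n + 1) * ((n : MvPowerSeries ℕ+ ℂ) + 1) =
          ((n + 1 : ℕ) : ℂ) • expLinearPart c (n + 1) := by
        rw [Algebra.smul_def, map_natCast, mul_comm]
        push_cast
        rfl
      rw [this, MvPowerSeries.coeff_smul]
      push_cast
      rfl
    rw [h2, coeff_expLinearPart]
    split_ifs with hw
    · rw [← Finset.mul_sum, ← Nat.cast_sum, Finset.Nat.sum_antidiagonal_eq_sum_range_succ_mk]
      have h3 : ∑ p ∈ range (n + 1), μ p.succPNat * (p + 1) = n + 1 := by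
        refine Eq.trans ?_ hw
        rw [timesWeight, Finsupp.weight_apply, Finsupp.sum_of_support_subset (s := (range (n + 1)).map ⟨Nat.succPNat,
          Nat.succPNat_injective⟩) _ _ _ (by simp), Finset.sum_map]
        · rfl
        · intro k hk
          have hkn : (k : ℕ) ≤ n + 1 := by
            rw [← hw]
            exact Finsupp.le_weight_of_ne_zero' (w := fun k : ℕ+ => (k : ℕ)) (Finsupp.mem_support_iff.1 hk)
          refine mem_map.2 ⟨k.natPred, mem_range.2 ?_, PNat.succPNat_natPred k⟩
          rw [← PNat.natPred_add_one k] at hkn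
          omega
      rw [h3]
      push_cast
      ring
    · simp

end

section

open Finset

/-! ### The modes act by finite combinations of coefficients -/

/-- Linear functionals depending on finitely many coefficients. -/
def coeffSpan : Submodule ℂ (MvPowerSeries ℕ+ ℂ →ₗ[ℂ] ℂ) :=
  Submodule.span ℂ (Set.range fun ν => MvPowerSeries.coeff ν)

theorem coeff_mem_coeffSpan (ν : ℕ+ →₀ ℕ) : MvPowerSeries.coeff ν ∈ coeffSpan :=
  Submodule.subset_span ⟨ν, rfl⟩

/-- Operators each of whose output coefficients depends on finitely many input coefficients. -/
def rowFinite : Subalgebra ℂ (Module.End ℂ (MvPowerSeries ℕ+ ℂ)) where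
  carrier := {T | ∀ f ∈ coeffSpan, f ∘ₗ T ∈ coeffSpan}
  mul_mem' := fun {S T} hS hT f hf => hT _ (hS f hf)
  add_mem' := fun {S T} hS hT f hf => by
    rw [LinearMap.comp_add]
    exact coeffSpan.add_mem (hS f hf) (hT f hf)
  algebraMap_mem' := fun r f hf => by
    have : f ∘ₗ (algebraMap ℂ (Module.End ℂ (MvPowerSeries ℕ+ ℂ)) r) = r • f := by
      ext F
      simp [Module.algebraMap_end_apply]
    rw [this]
    exact coeffSpan.smul_mem r hf

theorem mem_rowFinite_of_coeff {T : Module.End ℂ (MvPowerSeries ℕ+ ℂ)}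
    (h : ∀ ν, (MvPowerSeries.coeff ν) ∘ₗ T ∈ coeffSpan) : T ∈ rowFinite := by
  intro f hf
  induction hf using Submodule.span_induction with
  | mem f hf =>
    obtain ⟨ν, rfl⟩ := hf
    exact h ν
  | zero => rw [LinearMap.zero_comp]; exact coeffSpan.zero_mem
  | add f g _ _ hf hg => rw [LinearMap.add_comp]; exact coeffSpan.add_mem hf hg
  | smul r f _ hf => rw [LinearMap.smul_comp]; exact coeffSpan.smul_mem r hf

theorem dp_mem_rowFinite (k : ℕ+) : dp k ∈ rowFinite := by
  refine mem_rowFinite_of_coeff fun ν => ?_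
  have : (MvPowerSeries.coeff ν) ∘ₗ dp k =
      ((ν k : ℂ) + 1) • MvPowerSeries.coeff (ν + Finsupp.single k 1) := by
    ext F
    change MvPowerSeries.coeff ν (MvPowerSeries.pderiv ℂ k F) = _
    rw [MvPowerSeries.coeff_pderiv, LinearMap.smul_apply, smul_eq_mul, mul_comm]
  rw [this]
  exact coeffSpan.smul_mem _ (coeff_mem_coeffSpan _)

theorem mulLeft_mem_rowFinite (V : MvPowerSeries ℕ+ ℂ) : LinearMap.mulLeft ℂ V ∈ rowFinite := by
  classical
  refine mem_rowFinite_of_coeff fun ν => ?_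
  have : (MvPowerSeries.coeff ν) ∘ₗ LinearMap.mulLeft ℂ V =
      ∑ p ∈ antidiagonal ν, MvPowerSeries.coeff p.1 V • MvPowerSeries.coeff (R := ℂ) p.2 := by
    ext F
    simp [MvPowerSeries.coeff_mul, LinearMap.sum_apply]
  rw [this]
  exact coeffSpan.sum_mem fun p _ => coeffSpan.smul_mem _ (coeff_mem_coeffSpan _)

theorem expCoeff_mem {A : Type*} [Ring A] [Algebra ℂ A] (S : Subalgebra ℂ A) {a : ℕ+ → A}
    (h : ∀ k, a k ∈ S) (n : ℤ) : expCoeff a n ∈ S := by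
  unfold expCoeff
  split_ifs
  · refine S.sum_mem fun κ _ => S.smul_mem (S.list_prod_mem fun y hy => ?_) _
    obtain ⟨k, _, rfl⟩ := List.mem_map.1 hy
    exact h _
  · exact S.zero_mem

theorem minusBracket_mem_rowFinite (q t : ℂ) (N : ℕ) (n : ℤ) : minusBracket q t N n ∈ rowFinite := by
  refine rowFinite.sub_mem ?_ (rowFinite.smul_mem (expCoeff_mem _ (fun k =>
    rowFinite.smul_mem (dp_mem_rowFinite k) _) n) _)
  split_ifs
  · exact rowFinite.one_mem
  · exact rowFinite.zero_mem

theorem plusBracket_mem_rowFinite (q t : ℂ) (N : ℕ) (n : ℤ) : plusBracket q t N n ∈ rowFinite := by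
  refine rowFinite.sub_mem ?_ (rowFinite.smul_mem (expCoeff_mem _ (fun k =>
    rowFinite.smul_mem (dp_mem_rowFinite k) _) n) _)
  split_ifs
  · exact rowFinite.one_mem
  · exact rowFinite.zero_mem

/-- The exponents of the vertex operator. -/
def vertexSource (q t : ℂ) (k : ℕ+) : ℂ :=
  (1 - (t ^ (k : ℕ))⁻¹) * (t / q) ^ (k : ℕ) / ((k : ℕ) : ℂ)

theorem vertexCoeff_natCast (q t : ℂ) (a : ℕ) :
    vertexCoeff q t a = expLinearPart (vertexSource q t) a :=
  (expCoeff_eq_coeff (isExpSeries_expLinearPart (vertexSource q t)) a).trans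
    (PowerSeries.coeff_mk _ _)

/-- All monomials of the vertex coefficient have weight a, and weights are additive and nonnegative.
Hence the sum over a in a mode is finite. -/
theorem coeff_vertexCoeff_mul_eq_zero (q t : ℂ) {a : ℕ} {μ : ℕ+ →₀ ℕ} (h : timesWeight μ < a)
    (G : MvPowerSeries ℕ+ ℂ) : MvPowerSeries.coeff μ (vertexCoeff q t a * G) = 0 := by
  classical
  rw [MvPowerSeries.coeff_mul]
  refine Finset.sum_eq_zero fun p hp => ?_
  have hp' := mem_antidiagonal.1 hp
  rw [vertexCoeff_natCast, coeff_expLinearPart, if_neg, zero_mul]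
  rw [← hp', map_add] at h
  omega

theorem coeff_virasoroMode (q t : ℂ) (N : ℕ) (Mplus Mminus : Polynomial ℂ) (m : ℤ)
    (F : MvPowerSeries ℕ+ ℂ) (μ : ℕ+ →₀ ℕ) :
    MvPowerSeries.coeff μ (virasoroMode q t N Mplus Mminus m F) =
      (∑ l ∈ Mminus.support, Mminus.coeff l *
        MvPowerSeries.coeff μ (minusBracket q t N (l + m) F)) +
      q * t⁻¹ * ∑ l ∈ Mplus.support, Mplus.coeff l * ∑ a ∈ range (timesWeight μ + 1),
        MvPowerSeries.coeff μ (vertexCoeff q t a * plusBracket q t N (l + a + m) F) := by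
  change (Mminus.sum fun l c => c * MvPowerSeries.coeff μ (minusBracket q t N (l + m) F)) +
    q * t⁻¹ * (Mplus.sum fun l c => c * ∑ᶠ a : ℕ,
    MvPowerSeries.coeff μ (vertexCoeff q t a * plusBracket q t N (l + a + m) F)) = _
  rw [Polynomial.sum, Polynomial.sum]
  congr 2
  refine Finset.sum_congr rfl fun l _ => ?_
  rw [finsum_eq_sum_of_support_subset]
  intro a ha
  by_contra h
  exact ha (coeff_vertexCoeff_mul_eq_zero q t (by simpa using h) _)

theorem exists_coeffSpan_virasoroMode (q t : ℂ) (N : ℕ) (Mplus Mminus : Polynomial ℂ) (m : ℤ)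
    (μ : ℕ+ →₀ ℕ) : ∃ f ∈ coeffSpan, ∀ F,
      MvPowerSeries.coeff μ (virasoroMode q t N Mplus Mminus m F) = f F := by
  refine ⟨(∑ l ∈ Mminus.support, Mminus.coeff l •
        (MvPowerSeries.coeff μ ∘ₗ minusBracket q t N (l + m))) +
      (q * t⁻¹) • ∑ l ∈ Mplus.support, Mplus.coeff l • ∑ a ∈ range (timesWeight μ + 1),
        (MvPowerSeries.coeff μ ∘ₗ LinearMap.mulLeft ℂ (vertexCoeff q t a)) ∘ₗ
          plusBracket q t N (l + a + m), ?_, fun F => ?_⟩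
  · refine coeffSpan.add_mem (coeffSpan.sum_mem fun l _ => coeffSpan.smul_mem _ ?_)
      (coeffSpan.smul_mem _ (coeffSpan.sum_mem fun l _ => coeffSpan.smul_mem _
        (coeffSpan.sum_mem fun a _ => ?_)))
    · exact minusBracket_mem_rowFinite q t N _ _ (coeff_mem_coeffSpan μ)
    · exact plusBracket_mem_rowFinite q t N _ _
        (mulLeft_mem_rowFinite _ _ (coeff_mem_coeffSpan μ))
  · rw [coeff_virasoroMode]
    simp [LinearMap.sum_apply]

/-! ### The action on exponentials of power sums -/

/-- The coefficients `(1 - t^k)/(1 - q^k) (1/k) ∑_i x_i^k` of the times. -/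
def modelSource (q t : ℂ) {N : ℕ} (x : Fin N → ℂ) (k : ℕ+) : ℂ :=
  (1 - t ^ (k : ℕ)) / (1 - q ^ (k : ℕ)) / ((k : ℕ) : ℂ) * ∑ i, x i ^ (k : ℕ)

section

variable {q t : ℂ} {N : ℕ} {x : Fin N → ℂ}

theorem one_sub_pow_ne_zero (hq1 : ‖q‖ < 1) (k : ℕ+) : 1 - q ^ (k : ℕ) ≠ 0 := by
  intro h
  have h1 : ‖q ^ (k : ℕ)‖ < 1 := by
    rw [norm_pow]
    exact pow_lt_one₀ (norm_nonneg _) hq1 k.ne_zero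
  rw [← sub_eq_zero.1 h, norm_one] at h1
  exact lt_irrefl _ h1

theorem int_eq_natCast_or_neg_one {n : ℤ} (hn : -1 ≤ n) : n = -1 ∨ ∃ k : ℕ, n = k := by
  rcases hn.eq_or_lt with h | h
  · exact Or.inl h.symm
  · exact Or.inr ⟨n.toNat, by omega⟩

/-- The factor 1 - q^k cancels against the source, leaving the exponent treated by
`expCoeff_powerSum` with c = t. At n = -1 the left side is zero, and the subtracted ∑ 1/x_i removes
the value of the sum over poles. -/
theorem minusBracket_expLinear (hq1 : ‖q‖ < 1) (ht0 : t ≠ 0) (hx : Function.Injective x)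
    (hx0 : ∀ i, x i ≠ 0) {n : ℤ} (hn : -1 ≤ n) :
    minusBracket q t N n (expLinear (modelSource q t x)) =
      ((1 - t⁻¹) * ((∑ i, shiftFactor t⁻¹ x i (x i) * x i ^ n) -
        if n = -1 then ∑ i, (x i)⁻¹ else 0)) • expLinear (modelSource q t x) := by
  have hev : ∀ k : ℕ+, ((1 - q ^ (k : ℕ)) • dp k) (expLinear (modelSource q t x)) =
      ((1 - t ^ (k : ℕ)) / ((k : ℕ) : ℂ) * ∑ i, x i ^ (k : ℕ)) •
        expLinear (modelSource q t x) := fun k => by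
    rw [LinearMap.smul_apply, dp_expLinear, smul_smul, modelSource]
    congr 1
    have := one_sub_pow_ne_zero hq1 k
    field_simp
  rw [minusBracket, LinearMap.sub_apply, LinearMap.smul_apply, expCoeff_apply_of_eigenvector hev]
  rcases int_eq_natCast_or_neg_one hn with rfl | ⟨n, rfl⟩
  · have := sum_shiftFactor_div (inv_ne_zero ht0) hx hx0
    rw [expCoeff_of_neg _ (by norm_num), if_neg (by norm_num)]
    simp only [zpow_neg_one, if_true, mul_sub, this, sub_self]
    simp
  · have h := expCoeff_powerSum ht0 hx hx0 n
    simp only [zpow_natCast]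
    rw [if_neg (by omega : ¬ (n : ℤ) = -1), sub_zero, ← h, smul_smul, sub_smul]
    congr 1
    by_cases hn0 : n = 0 <;> simp [hn0]

/-- The same with c = t⁻¹ and the points q x_i: -(1 - t^k)(t/q)^{-k} = (1 - t^{-k}) q^k. The shift
factors are invariant under the common dilation by q. -/
theorem plusBracket_expLinear (hq0 : q ≠ 0) (hq1 : ‖q‖ < 1) (ht0 : t ≠ 0)
    (hx : Function.Injective x) (hx0 : ∀ i, x i ≠ 0) {n : ℤ} (hn : -1 ≤ n) :
    plusBracket q t N n (expLinear (modelSource q t x)) =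
      ((1 - t) * ((∑ i, shiftFactor t x i (x i) * (q * x i) ^ n) -
        if n = -1 then q⁻¹ * ∑ i, (x i)⁻¹ else 0)) • expLinear (modelSource q t x) := by
  have hev : ∀ k : ℕ+, ((-((1 - q ^ (k : ℕ)) * ((t / q) ^ (k : ℕ))⁻¹)) • dp k)
      (expLinear (modelSource q t x)) =
      ((1 - t⁻¹ ^ (k : ℕ)) / ((k : ℕ) : ℂ) * ∑ i, (q * x i) ^ (k : ℕ)) •
        expLinear (modelSource q t x) := fun k => by
    rw [LinearMap.smul_apply, dp_expLinear, smul_smul, modelSource]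
    congr 1
    have := one_sub_pow_ne_zero hq1 k
    simp_rw [mul_pow, ← Finset.mul_sum, div_pow, inv_pow]
    field_simp
    ring
  rw [plusBracket, LinearMap.sub_apply, LinearMap.smul_apply, expCoeff_apply_of_eigenvector hev]
  rcases int_eq_natCast_or_neg_one hn with rfl | ⟨n, rfl⟩
  · have := sum_shiftFactor_div ht0 hx hx0
    rw [expCoeff_of_neg _ (by norm_num), if_neg (by norm_num)]
    simp only [zpow_neg_one, if_true, mul_inv, mul_left_comm _ q⁻¹, ← Finset.mul_sum, ← mul_sub]
    rw [mul_sub (1 - t), this]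
    simp
  · have h := expCoeff_powerSum (inv_ne_zero ht0) (x := fun i => q * x i)
      (fun i j h => hx (mul_left_cancel₀ hq0 h)) (fun i => mul_ne_zero hq0 (hx0 i)) n
    have hB : ∀ i, shiftFactor t (fun i => q * x i) i (q * x i) = shiftFactor t x i (x i) :=
      fun i => by
        rw [shiftFactor, shiftFactor]
        refine Finset.prod_congr rfl fun j _ => ?_
        rw [mul_left_comm, ← mul_sub, ← mul_sub, mul_div_mul_left _ _ hq0]
    simp only [inv_inv, hB, inv_pow] at h
    simp only [zpow_natCast, inv_pow]
    rw [if_neg (by omega : ¬ (n : ℤ) = -1), sub_zero, ← h, smul_smul, sub_smul]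
    congr 1
    by_cases hn0 : n = 0 <;> simp [hn0]

/-- The vertex operator dilates one variable. -/
theorem sum_coeff_vertexCoeff_mul (hq0 : q ≠ 0) (hq1 : ‖q‖ < 1) (ht0 : t ≠ 0) (i : Fin N)
    (μ : ℕ+ →₀ ℕ) :
    ∑ a ∈ range (timesWeight μ + 1), (q * x i) ^ a *
        MvPowerSeries.coeff μ (vertexCoeff q t a * expLinear (modelSource q t x)) =
      expLinearCoeff (modelSource q t (Function.update x i (q * x i))) μ := by
  classical
  -- Replacing x_i by q x_i changes the k-th source by -(1 - t^k) x_i^k/k, which equals (1 -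
  -- t^{-k})(t/q)^k (q x_i)^k/k, the vertex exponent at z = q x_i.
  have hsrc : modelSource q t (Function.update x i (q * x i)) =
      (fun k => vertexSource q t k * (q * x i) ^ (k : ℕ)) + modelSource q t x := by
    funext k
    have := one_sub_pow_ne_zero hq1 k
    have hs : ∑ j, Function.update x i (q * x i) j ^ (k : ℕ) =
        ∑ j, x j ^ (k : ℕ) - (1 - q ^ (k : ℕ)) * x i ^ (k : ℕ) := by
      rw [← Finset.add_sum_erase _ _ (mem_univ i), ← Finset.add_sum_erase univ _ (mem_univ i),
        Function.update_self, Finset.sum_congr rfl fun j hj => by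
          rw [Function.update_of_ne (mem_erase.1 hj).1], mul_pow]
      ring
    rw [Pi.add_apply, modelSource, modelSource, hs, vertexSource, div_pow, mul_pow]
    field_simp
    ring
  have hpow : ∀ ν : ℕ+ →₀ ℕ, expLinearCoeff (fun k => vertexSource q t k * (q * x i) ^ (k : ℕ)) ν =
      (q * x i) ^ timesWeight ν * expLinearCoeff (vertexSource q t) ν := fun ν => by
    rw [expLinearCoeff, expLinearCoeff, timesWeight, Finsupp.weight_apply, Finsupp.sum,
      Finsupp.prod, Finsupp.prod, ← Finset.prod_pow_eq_pow_sum, ← Finset.prod_mul_distrib]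
    refine Finset.prod_congr rfl fun k _ => ?_
    rw [mul_pow, ← pow_mul, smul_eq_mul, mul_comm (k : ℕ)]
    ring
  rw [hsrc, ← coeff_expLinear, ← expLinear_mul, MvPowerSeries.coeff_mul]
  simp_rw [MvPowerSeries.coeff_mul, Finset.mul_sum]
  rw [Finset.sum_comm]
  refine Finset.sum_congr rfl fun p hp => ?_
  have hp' := mem_antidiagonal.1 hp
  have hw : timesWeight p.1 ∈ range (timesWeight μ + 1) := by
    rw [← hp', map_add, mem_range]
    omega
  rw [Finset.sum_eq_single_of_mem _ hw fun a _ ha => by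
    rw [vertexCoeff_natCast, coeff_expLinearPart, if_neg (Ne.symm ha), zero_mul, mul_zero],
    vertexCoeff_natCast, coeff_expLinearPart, if_pos rfl, coeff_expLinear, coeff_expLinear, hpow,
    mul_assoc]

theorem sum_coeff_mul_zpow (M : Polynomial ℂ) {z : ℂ} (hz : z ≠ 0) (m : ℤ) :
    ∑ l ∈ M.support, M.coeff l * z ^ ((l : ℤ) + m) = M.eval z * z ^ m := by
  rw [Polynomial.eval_eq_sum, Polynomial.sum, Finset.sum_mul]
  refine Finset.sum_congr rfl fun l _ => ?_
  rw [zpow_add₀ hz, zpow_natCast, mul_assoc]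

theorem sum_ite_eq_neg_one (M : Polynomial ℂ) {m : ℤ} (hm : -1 ≤ m) (c : ℂ) :
    ∑ l ∈ M.support, M.coeff l * (if (l : ℤ) + m = -1 then c else 0) =
      if m = -1 then M.eval 0 * c else 0 := by
  rw [Finset.sum_eq_single 0]
  · rw [← Polynomial.coeff_zero_eq_eval_zero]
    simp
  · intro l _ hl
    rw [if_neg (by omega), mul_zero]
  · intro h
    rw [Polynomial.notMem_support_iff.1 h, zero_mul]

/-- Summing modes against z-powers evaluates M⁻ at the poles x_i, and M⁺ with the vertex operator at
the poles q x_i. As m ≥ -1, only indices n ≥ -1 occur, and n = -1 arises only from l = 0 and a = 0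
with m = -1. -/
theorem coeff_virasoroMode_expLinear (hq0 : q ≠ 0) (hq1 : ‖q‖ < 1) (ht0 : t ≠ 0)
    (hx : Function.Injective x) (hx0 : ∀ i, x i ≠ 0) (Mplus Mminus : Polynomial ℂ) {m : ℤ}
    (hm : -1 ≤ m) (hM : m = -1 → Mplus.eval 0 = Mminus.eval 0) (μ : ℕ+ →₀ ℕ) :
    MvPowerSeries.coeff μ (virasoroMode q t N Mplus Mminus m (expLinear (modelSource q t x))) =
      (1 - t⁻¹) * ∑ i, (shiftFactor t⁻¹ x i (x i) *
          (Mminus.eval (x i) * x i ^ m * expLinearCoeff (modelSource q t x) μ) -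
        q * (shiftFactor t x i (x i) * (Mplus.eval (q * x i) * (q * x i) ^ m *
          expLinearCoeff (modelSource q t (Function.update x i (q * x i))) μ))) := by
  set e := expLinearCoeff (modelSource q t x) μ with he
  set S := ∑ i, (x i)⁻¹ with hS
  have h0 : vertexCoeff q t ((0 : ℕ) : ℤ) = 1 := by
    rw [vertexCoeff_natCast, ← PowerSeries.coeff_mk 0 (expLinearPart (vertexSource q t)),
      PowerSeries.coeff_zero_eq_constantCoeff_apply,
      (isExpSeries_expLinearPart (vertexSource q t)).1]
  have hpoly : ∀ (M : Polynomial ℂ) (b z f : Fin N → ℂ) (c : ℂ), (∀ i, z i ≠ 0) →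
      ∑ l ∈ M.support, M.coeff l * ((∑ i, b i * (z i ^ ((l : ℤ) + m) * f i)) -
        if (l : ℤ) + m = -1 then c else 0) =
      (∑ i, b i * (M.eval (z i) * z i ^ m * f i)) - if m = -1 then M.eval 0 * c else 0 := by
    intro M b z f c hz
    rw [← sum_ite_eq_neg_one M hm c]
    simp_rw [mul_sub, Finset.sum_sub_distrib, Finset.mul_sum]
    rw [Finset.sum_comm]
    congr 1
    refine Finset.sum_congr rfl fun i _ => ?_
    rw [← sum_coeff_mul_zpow M (hz i) m, Finset.sum_mul, Finset.mul_sum]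
    exact Finset.sum_congr rfl fun l _ => by ring
  have h1 : ∀ l : ℕ, MvPowerSeries.coeff μ
      (minusBracket q t N (l + m) (expLinear (modelSource q t x))) =
      (1 - t⁻¹) * ((∑ i, shiftFactor t⁻¹ x i (x i) * (x i ^ ((l : ℤ) + m) * e)) -
        if (l : ℤ) + m = -1 then S * e else 0) := by
    intro l
    rw [minusBracket_expLinear hq1 ht0 hx hx0 (by omega), MvPowerSeries.coeff_smul, coeff_expLinear,
      ← he, ← hS, mul_assoc, sub_mul (Finset.sum _ _), Finset.sum_mul, ite_mul, zero_mul]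
    simp_rw [mul_assoc]
  have h2 : ∀ l : ℕ, ∑ a ∈ range (timesWeight μ + 1), MvPowerSeries.coeff μ (vertexCoeff q t a *
      plusBracket q t N (l + a + m) (expLinear (modelSource q t x))) =
      (1 - t) * ((∑ i, shiftFactor t x i (x i) * ((q * x i) ^ ((l : ℤ) + m) *
        expLinearCoeff (modelSource q t (Function.update x i (q * x i))) μ)) -
        if (l : ℤ) + m = -1 then q⁻¹ * S * e else 0) := by
    intro l
    have h3 : ∀ a : ℕ, MvPowerSeries.coeff μ (vertexCoeff q t a *
        plusBracket q t N (l + a + m) (expLinear (modelSource q t x))) =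
        (1 - t) * ((∑ i, shiftFactor t x i (x i) * ((q * x i) ^ ((l : ℤ) + m) * ((q * x i) ^ a *
          MvPowerSeries.coeff μ (vertexCoeff q t a * expLinear (modelSource q t x))))) -
          if (l : ℤ) + a + m = -1 then q⁻¹ * S *
            MvPowerSeries.coeff μ (vertexCoeff q t a * expLinear (modelSource q t x)) else 0) := by
      intro a
      rw [plusBracket_expLinear hq0 hq1 ht0 hx hx0 (by omega), mul_smul_comm,
        MvPowerSeries.coeff_smul, ← hS, mul_assoc, sub_mul (Finset.sum _ _), Finset.sum_mul, ite_mul, zero_mul]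
      congr 2
      refine Finset.sum_congr rfl fun i _ => ?_
      rw [show (l : ℤ) + a + m = ((l : ℤ) + m) + a by ring,
        zpow_add₀ (mul_ne_zero hq0 (hx0 i)), zpow_natCast]
      ring
    simp_rw [h3]
    rw [← Finset.mul_sum, Finset.sum_sub_distrib, Finset.sum_comm]
    congr 2
    · refine Finset.sum_congr rfl fun i _ => ?_
      rw [← Finset.mul_sum, ← Finset.mul_sum, sum_coeff_vertexCoeff_mul hq0 hq1 ht0]
    · rw [Finset.sum_eq_single_of_mem 0 (mem_range.2 (Nat.succ_pos _))]
      · rw [h0, one_mul, coeff_expLinear, Nat.cast_zero, add_zero, ← he]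
      · intro a _ ha
        rw [if_neg (by omega)]
  rw [coeff_virasoroMode]
  simp_rw [h1, h2, mul_left_comm (Polynomial.coeff _ _), ← Finset.mul_sum]
  rw [hpoly Mminus _ x (fun _ => e) (S * e) hx0,
    hpoly Mplus _ (fun i => q * x i) _ (q⁻¹ * S * e) fun i => mul_ne_zero hq0 (hx0 i),
    Finset.sum_sub_distrib, ← Finset.mul_sum]
  generalize ∑ i, shiftFactor t⁻¹ x i (x i) * (Mminus.eval (x i) * x i ^ m * e) = T₁
  generalize ∑ i, shiftFactor t x i (x i) * (Mplus.eval (q * x i) * (q * x i) ^ m *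
    expLinearCoeff (modelSource q t (Function.update x i (q * x i))) μ) = T₂
  -- The q⁻¹ in the second correction cancels the prefactor q, and t⁻¹(1 - t) = -(1 - t⁻¹), so the
  -- corrections cancel when M⁺(0) = M⁻(0).
  by_cases hm1 : m = -1
  · rw [if_pos hm1, if_pos hm1, hM hm1]
    field_simp
    ring
  · rw [if_neg hm1, if_neg hm1]
    field_simp
    ring

end

end

section

open MeasureTheory Filter Set

/-! ### Iterated contour integrals -/

/-- Lebesgue measure on the unit cube. -/
abbrev cubeMeasure (N : ℕ) : Measure (Fin N → ℝ) := Measure.pi fun _ => unitMeasure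

theorem restrict_cube (N : ℕ) :
    (volume : Measure (Fin N → ℝ)).restrict (Icc 0 1) = cubeMeasure N := by
  rw [cubeMeasure, unitMeasure, ← Measure.restrict_pi_pi, ← volume_pi]
  congr 1
  exact (Set.pi_univ_Icc _ _).symm

theorem ae_cubeMeasure_mem (N : ℕ) : ∀ᵐ s ∂cubeMeasure N, ∀ j, s j ∈ Icc (0 : ℝ) 1 := by
  rw [← restrict_cube]
  filter_upwards [ae_restrict_mem measurableSet_Icc] with s hs j
  exact ⟨hs.1 j, hs.2 j⟩

/-- Bounded measurable functions. -/
def BoundedMeasurable {X : Type*} [MeasurableSpace X] (H : X → ℂ) : Prop :=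
  Measurable H ∧ ∃ B, ∀ s, ‖H s‖ ≤ B

section BoundedMeasurable

variable {X : Type*} [MeasurableSpace X]

theorem BoundedMeasurable.mul {H G : X → ℂ} (hH : BoundedMeasurable H) (hG : BoundedMeasurable G) :
    BoundedMeasurable fun s => H s * G s := by
  obtain ⟨B, hB⟩ := hH.2
  obtain ⟨B', hB'⟩ := hG.2
  refine ⟨hH.1.mul hG.1, B * B', fun s => ?_⟩
  rw [norm_mul]
  exact mul_le_mul (hB s) (hB' s) (norm_nonneg _) ((norm_nonneg _).trans (hB s))

theorem BoundedMeasurable.prod {ι : Type*} (T : Finset ι) {H : ι → X → ℂ}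
    (h : ∀ i ∈ T, BoundedMeasurable (H i)) : BoundedMeasurable fun s => ∏ i ∈ T, H i s := by
  classical
  induction T using Finset.induction_on with
  | empty => exact ⟨by simp, 1, by simp⟩
  | insert i T hi ih =>
    simp_rw [Finset.prod_insert hi]
    exact (h i (Finset.mem_insert_self _ _)).mul
      (ih fun j hj => h j (Finset.mem_insert_of_mem hj))

/-- On K the function differs from its continuous regularization at finitely many points only. This
yields measurability and boundedness although f itself is arbitrary elsewhere. -/
theorem boundedMeasurable_comp_of_regularAt {K : Set ℂ} (hK : IsCompact K) {f : ℂ → ℂ}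
    (hf : ∀ z ∈ K, RegularAt f z) {u : X → ℂ} (hu : Measurable u) (hmem : ∀ s, u s ∈ K) :
    BoundedMeasurable fun s => f (u s) := by
  have hcont : ContinuousOn (regularization f) K := fun z hz =>
    (hf z hz).analyticAt.continuousAt.continuousWithinAt
  have hfin : {z ∈ K | ¬ f z = regularization f z}.Finite :=
    finite_of_eventually_punctured hK fun p hp => (hf p hp).eventually_eq
  constructor
  · have h1 : Measurable (K.indicator (regularization f)) := by
      classical
      rw [← Set.piecewise_eq_indicator]
      exact hcont.measurable_piecewise continuousOn_const hK.measurableSet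
    have h2 : Measurable (K.indicator f) := by
      refine h1.measurable_of_countable_ne (hfin.countable.mono fun z hz => ?_)
      by_cases hzK : z ∈ K
      · refine ⟨hzK, fun h => hz ?_⟩
        rw [indicator_of_mem hzK, indicator_of_mem hzK, h]
      · exact absurd (by rw [indicator_of_notMem hzK, indicator_of_notMem hzK]) hz
    have e : (fun s => f (u s)) = K.indicator f ∘ u :=
      funext fun s => (indicator_of_mem (hmem s) f).symm
    rw [e]
    exact h2.comp hu
  · obtain ⟨B, hB⟩ := hK.exists_bound_of_continuousOn hcont
    obtain ⟨B', hB'⟩ := (hfin.image fun z => ‖f z‖).bddAbove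
    refine ⟨max B B', fun s => ?_⟩
    by_cases h : f (u s) = regularization f (u s)
    · simp only [h]
      exact (hB _ (hmem s)).trans (le_max_left _ _)
    · exact (hB' ⟨u s, ⟨hmem s, h⟩, rfl⟩).trans (le_max_right _ _)

end BoundedMeasurable

section Multi

variable {N : ℕ} (C : Fin N → Cycle)

/-- The point of the contour with given parameters. -/
def contourPoint (c : ∀ j, Fin (C j).size) (s : Fin N → ℝ) (j : Fin N) : ℂ :=
  (C j).curve (c j) (s j)

/-- The Jacobian of the parametrisation of the contour. -/
def contourJacobian (c : ∀ j, Fin (C j).size) (s : Fin N → ℝ) : ℂ :=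
  ∏ j, deriv ((C j).curve (c j)) (s j)

/-- Absolute convergence of an iterated contour integral. -/
def MultiIntegrable (F : (Fin N → ℂ) → ℂ) : Prop :=
  ∀ c : ∀ j, Fin (C j).size, Integrable
    (fun s => F (contourPoint C c s) * contourJacobian C c s) (cubeMeasure N)

theorem multiIntegral_eq (F : (Fin N → ℂ) → ℂ) : multiIntegral C F =
    ∑ c, ∫ s, F (contourPoint C c s) * contourJacobian C c s ∂cubeMeasure N := by
  rw [multiIntegral, ← restrict_cube]
  rfl

variable {C}

theorem MultiIntegrable.add {F G : (Fin N → ℂ) → ℂ} (hF : MultiIntegrable C F)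
    (hG : MultiIntegrable C G) : MultiIntegrable C fun x => F x + G x := fun c => by
  simp_rw [add_mul]
  exact (hF c).add (hG c)

theorem MultiIntegrable.const_mul {F : (Fin N → ℂ) → ℂ} (hF : MultiIntegrable C F) (a : ℂ) :
    MultiIntegrable C fun x => a * F x := fun c => by
  simp_rw [mul_assoc]
  exact (hF c).const_mul a

theorem multiIntegral_add {F G : (Fin N → ℂ) → ℂ} (hF : MultiIntegrable C F)
    (hG : MultiIntegrable C G) :
    multiIntegral C (fun x => F x + G x) = multiIntegral C F + multiIntegral C G := by
  simp_rw [multiIntegral_eq, add_mul]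
  rw [← Finset.sum_add_distrib]
  exact Finset.sum_congr rfl fun c _ => integral_add (hF c) (hG c)

theorem multiIntegral_const_mul (F : (Fin N → ℂ) → ℂ) (a : ℂ) :
    multiIntegral C (fun x => a * F x) = a * multiIntegral C F := by
  simp_rw [multiIntegral_eq, mul_assoc, integral_const_mul]
  rw [Finset.mul_sum]

theorem multiIntegral_zero : multiIntegral C (fun _ => 0) = 0 := by
  simp [multiIntegral_eq]

theorem multiIntegrable_zero : MultiIntegrable C fun _ => 0 := fun c => by simp

theorem multiIntegral_sum {ι : Type*} (T : Finset ι) {F : ι → (Fin N → ℂ) → ℂ}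
    (h : ∀ i ∈ T, MultiIntegrable C (F i)) :
    multiIntegral C (fun x => ∑ i ∈ T, F i x) = ∑ i ∈ T, multiIntegral C (F i) := by
  simp_rw [multiIntegral_eq, Finset.sum_mul]
  rw [Finset.sum_comm]
  exact Finset.sum_congr rfl fun c _ => integral_finsetSum _ fun i hi => h i hi c

theorem contourPoint_mem {c : ∀ j, Fin (C j).size} {s : Fin N → ℝ} (hs : ∀ j, s j ∈ Icc (0 : ℝ) 1)
    (j : Fin N) : contourPoint C c s j ∈ (C j).points :=
  mem_iUnion.2 ⟨c j, mem_image_of_mem _ (hs j)⟩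

theorem multiIntegral_congr {F G : (Fin N → ℂ) → ℂ}
    (h : ∀ x, (∀ j, x j ∈ (C j).points) → F x = G x) : multiIntegral C F = multiIntegral C G := by
  rw [multiIntegral_eq, multiIntegral_eq]
  refine Finset.sum_congr rfl fun c _ => integral_congr_ae ?_
  filter_upwards [ae_cubeMeasure_mem N] with s hs
  simp only [h _ (contourPoint_mem hs)]

theorem MultiIntegrable.congr {F G : (Fin N → ℂ) → ℂ} (hF : MultiIntegrable C F)
    (h : ∀ x, (∀ j, x j ∈ (C j).points) → F x = G x) : MultiIntegrable C G := fun c => by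
  refine (hF c).congr ?_
  filter_upwards [ae_cubeMeasure_mem N] with s hs
  simp only [h _ (contourPoint_mem hs)]

/-- Functions built from factors regular on the contour are integrable. -/
theorem multiIntegrable_of_regularAt {ω : ℂ → ℂ} {R : Fin N → Fin N → ℂ → ℂ}
    {g : (Fin N → ℂ) → ℂ} (hω : ∀ i, ∀ x ∈ (C i).points, RegularAt ω x)
    (hR : ∀ i j, i ≠ j → ∀ x ∈ (C i).points, ∀ y ∈ (C j).points, RegularAt (R i j) (x / y))
    (hg : ContinuousOn g (univ.pi fun j => (C j).points)) :
    MultiIntegrable C fun x =>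
      (∏ i, ∏ j ∈ Finset.univ.erase i, R i j (x i / x j)) * (∏ i, ω (x i)) * g x := by
  intro c
  set P : (Fin N → ℝ) → Fin N → ℂ := fun s j => (C j).path (c j) (s j) with hP
  have hPc : Continuous P := continuous_pi fun j =>
    ((C j).continuous_path (c j)).comp (continuous_apply j)
  have hPj : ∀ j, Continuous fun s => P s j := fun j => (continuous_apply j).comp hPc
  have hPm : ∀ s j, P s j ∈ (C j).points := fun s j => (C j).path_mem _ _
  have hbm : BoundedMeasurable fun s =>
      (∏ i, ∏ j ∈ Finset.univ.erase i, R i j (P s i / P s j)) * (∏ i, ω (P s i)) * g (P s) := by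
    refine ((BoundedMeasurable.prod _ fun i _ => BoundedMeasurable.prod _ fun j hj => ?_).mul
      (BoundedMeasurable.prod _ fun i _ => ?_)).mul ?_
    · have hij : i ≠ j := (Finset.ne_of_mem_erase hj).symm
      have hK : IsCompact ((fun p : ℂ × ℂ => p.1 / p.2) '' ((C i).points ×ˢ (C j).points)) := by
        refine ((C i).isCompact_points.prod (C j).isCompact_points).image_of_continuousOn ?_
        exact continuousOn_fst.div continuousOn_snd fun p hp =>
          (C j).ne_zero_of_mem_points hp.2
      refine boundedMeasurable_comp_of_regularAt hK ?_
        ((hPj i).measurable.div (hPj j).measurable) fun s => ⟨(P s i, P s j), ⟨hPm s i, hPm s j⟩, rfl⟩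
      rintro _ ⟨p, hp, rfl⟩
      exact hR i j hij _ hp.1 _ hp.2
    · exact boundedMeasurable_comp_of_regularAt (C i).isCompact_points (hω i) (hPj i).measurable
        fun s => hPm s i
    · have hcomp : IsCompact (univ.pi fun j => (C j).points) :=
        isCompact_univ_pi fun j => (C j).isCompact_points
      obtain ⟨B, hB⟩ := hcomp.exists_bound_of_continuousOn hg
      exact ⟨(hg.comp_continuous hPc fun s j _ => hPm s j).measurable, B,
        fun s => hB _ fun j _ => hPm s j⟩
  have hjac : Integrable (contourJacobian C c) (cubeMeasure N) :=
    Integrable.fintype_prod fun j => (C j).integrable_deriv (c j)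
  obtain ⟨B, hB⟩ := hbm.2
  refine (hjac.bdd_mul hbm.1.aestronglyMeasurable (Eventually.of_forall hB)).congr ?_
  filter_upwards [ae_cubeMeasure_mem N] with s hs
  have : P s = contourPoint C c s := funext fun j => (C j).path_eq (hs j)
  rw [this]

/-- An iterated integral vanishes if the integral over one of the variables does. -/
theorem multiIntegral_eq_zero (i : Fin N) {F : (Fin N → ℂ) → ℂ} (hF : MultiIntegrable C F)
    (h : ∀ x : Fin N → ℂ, (∀ j, j ≠ i → x j ∈ (C j).points) →
      (C i).integral (fun z => F (Function.update x i z)) = 0) : multiIntegral C F = 0 := by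
  rcases N with _ | n
  · exact i.elim0
  -- Separate the i-th curve and parameter from the others. After Fubini, the inner integral summed
  -- over the curves of C_i is the full contour integral in x_i.
  rw [multiIntegral_eq, ← (Fin.insertNthEquiv (fun j => Fin (C j).size) i).sum_comp,
    Fintype.sum_prod_type_right]
  refine Finset.sum_eq_zero fun c' _ => ?_
  set e := MeasurableEquiv.piFinSuccAbove (fun _ : Fin (n + 1) => ℝ) i with he
  have hmp : MeasurePreserving e (cubeMeasure (n + 1)) (unitMeasure.prod (cubeMeasure n)) :=
    measurePreserving_piFinSuccAbove (fun _ => unitMeasure) i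
  set G : Fin (C i).size → ℝ × (Fin n → ℝ) → ℂ := fun k p =>
    F (contourPoint C (i.insertNth k c') (i.insertNth p.1 p.2)) *
      contourJacobian C (i.insertNth k c') (i.insertNth p.1 p.2) with hG
  have hGe : ∀ k s, G k (e s) = F (contourPoint C (i.insertNth k c') s) *
      contourJacobian C (i.insertNth k c') s := fun k s => by
    have : i.insertNth (e s).1 (e s).2 = s := e.symm_apply_apply s
    simp only [hG, this]
  have hGint : ∀ k, Integrable (G k) (unitMeasure.prod (cubeMeasure n)) := fun k => by
    rw [← hmp.integrable_comp_emb e.measurableEmbedding]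
    refine (hF (i.insertNth k c')).congr (Eventually.of_forall fun s => ?_)
    exact (hGe k s).symm
  have h1 : ∀ k, ∫ s, F (contourPoint C (Fin.insertNthEquiv (fun j => Fin (C j).size) i (k, c')) s) *
      contourJacobian C (Fin.insertNthEquiv (fun j => Fin (C j).size) i (k, c')) s
        ∂cubeMeasure (n + 1) = ∫ y, ∫ a, G k (a, y) ∂unitMeasure ∂cubeMeasure n := fun k => by
    rw [← integral_prod_symm _ (hGint k), ← hmp.integral_comp e.measurableEmbedding]
    exact integral_congr_ae (Eventually.of_forall fun s => (hGe k s).symm)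
  simp_rw [h1]
  rw [← integral_finsetSum _ fun k _ => (hGint k).integral_prod_right]
  refine integral_eq_zero_of_ae ?_
  filter_upwards [ae_cubeMeasure_mem n] with y hy
  set x : Fin (n + 1) → ℂ := i.insertNth 0 fun j => (C (i.succAbove j)).curve (c' j) (y j) with hx
  have hxj : ∀ j, j ≠ i → x j ∈ (C j).points := fun j hj => by
    obtain ⟨k, rfl⟩ := Fin.exists_succAbove_eq hj
    rw [hx, Fin.insertNth_apply_succAbove]
    exact mem_iUnion.2 ⟨c' k, mem_image_of_mem _ (hy k)⟩
  have h2 : ∀ k a, G k (a, y) = F (Function.update x i ((C i).curve k a)) *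
      deriv ((C i).curve k) a * ∏ j, deriv ((C (i.succAbove j)).curve (c' j)) (y j) := fun k a => by
    have e1 : contourPoint C (i.insertNth k c') (i.insertNth a y) =
        Function.update x i ((C i).curve k a) := by
      funext j
      rcases eq_or_ne j i with rfl | hj
      · rw [Function.update_self, contourPoint, Fin.insertNth_apply_same, Fin.insertNth_apply_same]
      · obtain ⟨l, rfl⟩ := Fin.exists_succAbove_eq hj
        rw [Function.update_of_ne hj, contourPoint, hx, Fin.insertNth_apply_succAbove,
          Fin.insertNth_apply_succAbove, Fin.insertNth_apply_succAbove]
    have e2 : contourJacobian C (i.insertNth k c') (i.insertNth a y) =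
        deriv ((C i).curve k) a * ∏ j, deriv ((C (i.succAbove j)).curve (c' j)) (y j) := by
      rw [contourJacobian, Fin.prod_univ_succAbove _ i, Fin.insertNth_apply_same,
        Fin.insertNth_apply_same]
      congr 1
      refine Finset.prod_congr rfl fun l _ => ?_
      rw [Fin.insertNth_apply_succAbove, Fin.insertNth_apply_succAbove]
    simp only [hG, e1, e2, mul_assoc]
  simp_rw [h2, integral_mul_const]
  rw [← Finset.sum_mul, ← (C i).integral_eq (fun z => F (Function.update x i z)), h x hxj, zero_mul]
  rfl

end Multi

end

section

open MeasureTheory Filter Set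

/-! ### The infinite `q`-Pochhammer symbol -/

section Pochhammer

variable {q : ℂ}

theorem summable_norm_pow_mul (hq1 : ‖q‖ < 1) (z : ℂ) : Summable fun k : ℕ => ‖-(q ^ k * z)‖ := by
  simp_rw [norm_neg, norm_mul, norm_pow]
  exact (summable_geometric_of_lt_one (norm_nonneg _) hq1).mul_right _

theorem qPoch_eq_one_sub_mul (hq1 : ‖q‖ < 1) (z : ℂ) : qPoch q z = (1 - z) * qPoch q (q * z) := by
  have hm : Multipliable fun k : ℕ => 1 - q ^ k * (q * z) := by
    simp_rw [sub_eq_add_neg]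
    exact multipliable_one_add_of_summable (summable_norm_pow_mul hq1 _)
  have e : ∀ k : ℕ, 1 - q ^ k * (q * z) = 1 - q ^ (k + 1) * z := fun k => by ring
  rw [qPoch, tprod_eq_zero_mul' (f := fun k : ℕ => 1 - q ^ k * z) (by simpa only [e] using hm),
    pow_zero, one_mul, qPoch]
  simp_rw [e]

theorem qPoch_one (hq1 : ‖q‖ < 1) : qPoch q 1 = 0 := by
  rw [qPoch_eq_one_sub_mul hq1, sub_self, zero_mul]

theorem qPoch_ne_zero (hq1 : ‖q‖ < 1) {z : ℂ} (h : ∀ k : ℕ, q ^ k * z ≠ 1) : qPoch q z ≠ 0 := by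
  have := tprod_one_add_ne_zero_of_summable (f := fun k : ℕ => -(q ^ k * z))
    (fun k => by
      rw [← sub_eq_add_neg]
      exact sub_ne_zero.2 (h k).symm) (summable_norm_pow_mul hq1 z)
  rw [qPoch]
  simpa only [← sub_eq_add_neg] using this

theorem differentiable_qPoch (hq1 : ‖q‖ < 1) : Differentiable ℂ (qPoch q) := by
  intro z
  have hz : z ∈ Metric.ball (0 : ℂ) (‖z‖ + 1) := by simp
  have hprod := Summable.hasProdLocallyUniformlyOn_one_add
    (f := fun (k : ℕ) (z : ℂ) => -(q ^ k * z))
    (u := fun k => ‖q‖ ^ k * (‖z‖ + 1)) (K := Metric.ball (0 : ℂ) (‖z‖ + 1)) Metric.isOpen_ball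
    ((summable_geometric_of_lt_one (norm_nonneg _) hq1).mul_right _)
    (Eventually.of_forall fun k y hy => by
      rw [norm_neg, norm_mul, norm_pow]
      exact mul_le_mul_of_nonneg_left (by simpa using (mem_ball_zero_iff.1 hy).le) (by positivity))
    (fun k => by fun_prop)
  have hd := hprod.differentiableOn (Eventually.of_forall fun T => by
    simpa [Finset.prod_fn] using DifferentiableOn.finsetProd (fun _ _ => by fun_prop))
    Metric.isOpen_ball
  have := hd.differentiableAt (Metric.isOpen_ball.mem_nhds hz)
  change DifferentiableAt ℂ (fun z => ∏' k : ℕ, (1 - q ^ k * z)) z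
  simpa only [← sub_eq_add_neg] using this

theorem kernelFactor_one (hq1 : ‖q‖ < 1) (t : ℂ) : kernelFactor q t 1 = 0 := by
  rw [kernelFactor, qPoch_one hq1, zero_div]

theorem kernelFactor_shift (hq1 : ‖q‖ < 1) {t u : ℂ} (hu : t * u ≠ 1) :
    (1 - u) * kernelFactor q t (q * u) = (1 - t * u) * kernelFactor q t u := by
  have h : 1 - t * u ≠ 0 := sub_ne_zero.2 hu.symm
  rw [kernelFactor, kernelFactor, qPoch_eq_one_sub_mul hq1 u, qPoch_eq_one_sub_mul hq1 (t * u),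
    mul_left_comm t q u, ← mul_div_assoc, ← mul_div_assoc, mul_div_mul_left _ _ h]

/-- The factor of the integrand that is shifted by a `q`-difference operator is regular wherever
the kernel is. -/
theorem regularAt_ratio_mul_kernelFactor (hq1 : ‖q‖ < 1) {t : ℂ}
    (ht : ∀ k : ℕ, q ^ k * t ≠ 1) (c : ℂ) {u : ℂ} (hu : RegularAt (kernelFactor q t) u) :
    RegularAt (fun u => (c * u - 1) / (u - 1) * kernelFactor q t u) u := by
  by_cases hu1 : u = 1
  · subst hu1
    have hq := differentiable_qPoch hq1
    -- The factor 1 - u of (u;q)_∞ absorbs the pole at u = 1, and (t;q)_∞ ≠ 0. The case k = 0 of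
    -- `ht`, that is t ≠ 1, is needed here.
    refine ⟨fun u => -(c * u - 1) * qPoch q (q * u) / qPoch q (t * u), ?_, ?_⟩
    · have h1 : AnalyticAt ℂ (fun u => qPoch q (q * u)) 1 :=
        (hq.comp (differentiable_id.const_mul q)).analyticAt 1
      have h2 : AnalyticAt ℂ (fun u => qPoch q (t * u)) 1 :=
        (hq.comp (differentiable_id.const_mul t)).analyticAt 1
      refine AnalyticAt.div (AnalyticAt.mul ?_ h1) h2 ?_
      · fun_prop
      · rw [mul_one]
        exact qPoch_ne_zero hq1 ht
    · filter_upwards [self_mem_nhdsWithin] with y hy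
      have hy' : y - 1 ≠ 0 := sub_ne_zero.2 hy
      rw [kernelFactor, qPoch_eq_one_sub_mul hq1 y]
      field_simp
      ring
  · refine RegularAt.mul (AnalyticAt.regularAt ?_) hu
    have : u - 1 ≠ 0 := sub_ne_zero.2 hu1
    fun_prop (disch := assumption)

end Pochhammer

/-! ### The `q`-difference of the integrand -/

theorem eventually_punctured_notMem {T : Set ℂ} (hT : T.Finite) (p : ℂ) :
    ∀ᶠ z in 𝓝[≠] p, z ∉ T := by
  have h1 : ∀ᶠ z in 𝓝 p, z ∉ T \ {p} :=
    (hT.subset sdiff_subset).isClosed.isOpen_compl.mem_nhds (by simp)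
  filter_upwards [nhdsWithin_le_nhds h1, self_mem_nhdsWithin] with z hz hzp hzT
  exact hz ⟨hzT, hzp⟩

theorem eventually_punctured_eval_ne_zero {M : Polynomial ℂ} (hM : M ≠ 0) (p : ℂ) :
    ∀ᶠ z in 𝓝[≠] p, M.eval z ≠ 0 := by
  classical
  filter_upwards [eventually_punctured_notMem M.roots.toFinset.finite_toSet p] with z hz h
  exact hz (by simpa [hM] using h)

theorem tendsto_mul_punctured {q : ℂ} (hq : q ≠ 0) (p : ℂ) :
    Tendsto (fun z => q * z) (𝓝[≠] p) (𝓝[≠] (q * p)) :=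
  tendsto_nhdsWithin_iff.2 ⟨((continuous_const_mul q).tendsto p).mono_left nhdsWithin_le_nhds,
    eventually_mem_nhdsWithin.mono fun _ hz h => hz (mul_left_cancel₀ hq h)⟩

/-- Under z ↦ qz the exponent grows by (log t/log q)(N-1) log q, so the power contributes t^{N-1};
here N = n + 1. -/
theorem weightFactor_shift {logq logt q t : ℂ} (hq1 : ‖q‖ < 1)
    (hlogq : Complex.exp logq = q) (hlogt : Complex.exp logt = t)
    {L : ℂ → ℂ} (hLq : ∀ x, x ≠ 0 → L (q * x) = L x + logq) (n : ℕ) (w : ℂ → ℂ)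
    {Mplus Mminus : Polynomial ℂ} {z : ℂ} (hz : z ≠ 0)
    (hw : w (q * z) / w z = Mplus.eval (q * z) / Mminus.eval (q * z))
    (hp : Mplus.eval (q * z) ≠ 0) (hm : Mminus.eval (q * z) ≠ 0) :
    weightFactor logq logt L (n + 1) w (q * z) * Mminus.eval (q * z) =
      t ^ n * (weightFactor logq logt L (n + 1) w z * Mplus.eval (q * z)) := by
  have hlq : logq ≠ 0 := fun h => by
    rw [h, Complex.exp_zero] at hlogq
    rw [← hlogq, norm_one] at hq1
    exact lt_irrefl _ hq1
  -- If w z were 0 the quotient would be 0 by the convention for division, contradicting the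
  -- nonvanishing of both polynomials.
  have hwz : w z ≠ 0 := fun h => by
    rw [h, div_zero] at hw
    exact div_ne_zero hp hm hw.symm
  rw [div_eq_div_iff hwz hm] at hw
  have he : Complex.exp (logt / logq * (((n + 1 : ℕ) : ℂ) - 1) * L (q * z)) =
      t ^ n * Complex.exp (logt / logq * (((n + 1 : ℕ) : ℂ) - 1) * L z) := by
    rw [hLq z hz, ← hlogt, ← Complex.exp_nat_mul, ← Complex.exp_add]
    congr 1
    push_cast
    field_simp
    ring
  rw [weightFactor, weightFactor, he]
  linear_combination t ^ n * Complex.exp (logt / logq * (((n + 1 : ℕ) : ℂ) - 1) * L z) * hw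

section Integrand

variable {q t : ℂ} {N : ℕ}

open Finset in
theorem exists_integrand_update (ω : ℂ → ℂ) (x : Fin N → ℂ) (i : Fin N) :
    ∃ r, ∀ z, integrand q t ω (Function.update x i z) =
      (∏ j ∈ univ.erase i, kernelFactor q t (z / x j) * kernelFactor q t (x j / z)) * ω z * r := by
  refine ⟨(∏ a ∈ univ.erase i, ∏ b ∈ (univ.erase a).erase i, kernelFactor q t (x a / x b)) *
    ∏ a ∈ univ.erase i, ω (x a), fun z => ?_⟩
  have h1 : ∀ j ∈ univ.erase i, Function.update x i z j = x j := fun j hj =>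
    Function.update_of_ne (ne_of_mem_erase hj) _ _
  rw [integrand, kernel, ← mul_prod_erase univ _ (mem_univ i), ← mul_prod_erase univ
    (fun a => ω (Function.update x i z a)) (mem_univ i), Function.update_self,
    Finset.prod_congr rfl fun j hj => by rw [h1 j hj],
    Finset.prod_congr (s₁ := univ.erase i) (f := fun a => ω (Function.update x i z a)) rfl
      fun j hj => by rw [h1 j hj]]
  have h2 : ∀ a ∈ univ.erase i, ∏ b ∈ univ.erase a,
      kernelFactor q t (Function.update x i z a / Function.update x i z b) =
      kernelFactor q t (x a / z) * ∏ b ∈ (univ.erase a).erase i, kernelFactor q t (x a / x b) := by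
    intro a ha
    have hia : i ∈ univ.erase a := mem_erase.2 ⟨(ne_of_mem_erase ha).symm, mem_univ _⟩
    rw [← mul_prod_erase _ _ hia, Function.update_self, h1 a ha]
    congr 1
    refine Finset.prod_congr rfl fun b hb => ?_
    rw [Function.update_of_ne (ne_of_mem_erase hb)]
  rw [Finset.prod_congr rfl h2, Finset.prod_mul_distrib, Finset.prod_mul_distrib]
  ring

/-- Coincident coordinates produce a factor (1;q)_∞ = 0. This disposes of the points where partial
fractions are unavailable. -/
theorem integrand_eq_zero_of_not_injective (hq1 : ‖q‖ < 1) (ω : ℂ → ℂ) {x : Fin N → ℂ}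
    (hx0 : ∀ i, x i ≠ 0) (hx : ¬ Function.Injective x) : integrand q t ω x = 0 := by
  simp only [Function.Injective, not_forall] at hx
  obtain ⟨i, j, hij, hne⟩ := hx
  rw [integrand, kernel, Finset.prod_eq_zero (Finset.mem_univ i), zero_mul]
  refine Finset.prod_eq_zero (Finset.mem_erase.2 ⟨Ne.symm hne, Finset.mem_univ j⟩) ?_
  rw [hij, div_self (hx0 j), kernelFactor_one hq1]

/-- Apply `kernelFactor_shift` at u = z/y and at u = y/(qz). Each pair contributes t⁻¹, and the N-1
pairs together compensate the t^{N-1} of the weight. -/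
theorem kernelFactor_pair_shift (hq0 : q ≠ 0) (hq1 : ‖q‖ < 1) (ht0 : t ≠ 0) {z y : ℂ}
    (hz : z ≠ 0) (hy : y ≠ 0) (h1 : z ≠ y) (h2 : t * z ≠ y) (h3 : q * z ≠ y) (h4 : q * z ≠ t * y) :
    (t⁻¹ * (q * z) - y) / (q * z - y) *
        (kernelFactor q t (q * z / y) * kernelFactor q t (y / (q * z))) =
      t⁻¹ * ((t * z - y) / (z - y) * (kernelFactor q t (z / y) * kernelFactor q t (y / z))) := by
  have e1 := kernelFactor_shift hq1 (t := t) (u := z / y) fun h => h2 (by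
    rw [← mul_div_assoc, div_eq_one_iff_eq hy] at h
    exact h)
  have e2 := kernelFactor_shift hq1 (t := t) (u := y / (q * z)) fun h => h4 (by
    rw [← mul_div_assoc, div_eq_one_iff_eq (mul_ne_zero hq0 hz)] at h
    exact h.symm)
  rw [← mul_div_assoc] at e1
  rw [← mul_div_assoc, mul_div_mul_left _ _ hq0] at e2
  generalize kernelFactor q t (q * z / y) = k₁ at *
  generalize kernelFactor q t (y / (q * z)) = k₂ at *
  generalize kernelFactor q t (z / y) = k₃ at *
  generalize kernelFactor q t (y / z) = k₄ at *
  have d1 : z - y ≠ 0 := sub_ne_zero.2 h1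
  have d3 : q * z - y ≠ 0 := sub_ne_zero.2 h3
  have d4 : q * z - t * y ≠ 0 := sub_ne_zero.2 h4
  have f1 : k₁ = (t * z - y) / (z - y) * k₃ := by
    field_simp at e1 ⊢
    linear_combination -e1
  have f2 : k₂ = (q * z - y) / (q * z - t * y) * k₄ := by
    rw [div_mul_eq_mul_div, eq_div_iff d4]
    field_simp at e2
    linear_combination -e2
  rw [f1, f2]
  field_simp

/-- Outside a discrete set, the `q`-shift turns one family of coefficients into the other. -/
theorem shiftFactor_mul_integrand_shift {logq logt : ℂ}
    (hq0 : q ≠ 0) (hq1 : ‖q‖ < 1) (ht0 : t ≠ 0)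
    (hlogq : Complex.exp logq = q) (hlogt : Complex.exp logt = t)
    {L : ℂ → ℂ} (hLq : ∀ x, x ≠ 0 → L (q * x) = L x + logq) (w : ℂ → ℂ)
    {Mplus Mminus : Polynomial ℂ} (hMp : Mplus ≠ 0) (hMm : Mminus ≠ 0)
    (hw : ∀ z₀ : ℂ, z₀ ≠ 0 → ∀ᶠ z in 𝓝[≠] z₀,
      w z / w (q⁻¹ * z) = Mplus.eval z / Mminus.eval z)
    {x : Fin N → ℂ} {i : Fin N} (hx : ∀ j, j ≠ i → x j ≠ 0) {p : ℂ} (hp : p ≠ 0) :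
    ∀ᶠ z in 𝓝[≠] p,
      shiftFactor t⁻¹ x i (q * z) *
          integrand q t (weightFactor logq logt L N w) (Function.update x i (q * z)) *
          Mminus.eval (q * z) =
        shiftFactor t x i z *
          integrand q t (weightFactor logq logt L N w) (Function.update x i z) *
          Mplus.eval (q * z) := by
  rcases N with _ | n
  · exact i.elim0
  have hqp := tendsto_mul_punctured hq0 p
  obtain ⟨r, hr⟩ := exists_integrand_update (q := q) (t := t)
    (weightFactor logq logt L (n + 1) w) x i
  -- The points where a denominator used in `kernelFactor_pair_shift` vanishes.
  have hfin : (⋃ j, ({x j, t⁻¹ * x j, q⁻¹ * x j, q⁻¹ * (t * x j)} : Set ℂ)).Finite :=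
    Set.finite_iUnion fun j => by simp
  filter_upwards [hqp.eventually (hw (q * p) (mul_ne_zero hq0 hp)),
    hqp.eventually (eventually_punctured_eval_ne_zero hMp (q * p)),
    hqp.eventually (eventually_punctured_eval_ne_zero hMm (q * p)),
    eventually_punctured_notMem hfin p, eventually_punctured_notMem (Set.finite_singleton (0 : ℂ)) p]
    with z h1 h2 h3 h4 h5
  rw [inv_mul_cancel_left₀ hq0] at h1
  have hz : z ≠ 0 := h5
  have hω := weightFactor_shift hq1 hlogq hlogt hLq n w hz h1 h2 h3
  simp only [mem_iUnion, mem_insert_iff, mem_singleton_iff, not_exists, not_or] at h4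
  have hprod : shiftFactor t⁻¹ x i (q * z) * ∏ j ∈ Finset.univ.erase i,
      kernelFactor q t (q * z / x j) * kernelFactor q t (x j / (q * z)) =
      (t ^ n)⁻¹ * (shiftFactor t x i z * ∏ j ∈ Finset.univ.erase i,
        kernelFactor q t (z / x j) * kernelFactor q t (x j / z)) := by
    have e : (t ^ n)⁻¹ = ∏ _j ∈ Finset.univ.erase i, t⁻¹ := by
      rw [Finset.prod_const, Finset.card_erase_of_mem (Finset.mem_univ _), Finset.card_univ,
        Fintype.card_fin, inv_pow, Nat.add_sub_cancel]
    rw [e, shiftFactor, shiftFactor, ← Finset.prod_mul_distrib, ← Finset.prod_mul_distrib,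
      ← Finset.prod_mul_distrib]
    refine Finset.prod_congr rfl fun j hj => ?_
    obtain ⟨a1, a2, a3, a4⟩ := h4 j
    refine kernelFactor_pair_shift hq0 hq1 ht0 hz (hx j (Finset.ne_of_mem_erase hj)) a1
      (fun h => a2 ?_) (fun h => a3 ?_) (fun h => a4 ?_)
    · rw [← h, inv_mul_cancel_left₀ ht0]
    · rw [← h, inv_mul_cancel_left₀ hq0]
    · rw [← h, inv_mul_cancel_left₀ hq0]
  rw [hr, hr]
  have htn := pow_ne_zero n ht0
  calc _ = (shiftFactor t⁻¹ x i (q * z) * ∏ j ∈ Finset.univ.erase i,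
          kernelFactor q t (q * z / x j) * kernelFactor q t (x j / (q * z))) *
        (weightFactor logq logt L (n + 1) w (q * z) * Mminus.eval (q * z)) * r := by ring
    _ = _ := by
      rw [hprod, hω]
      field_simp

end Integrand

end

section

open MeasureTheory Filter Set

/-! ### Invariance of the contour integrals -/

namespace Cycle

/-- Merging the two integrals requires each to converge; f is regular on C because singular p avoid
C, and on qC because p/q does. -/
theorem integral_sub_shift_eq_zero (C : Cycle) {q : ℂ} (hq : q ≠ 0) {f : ℂ → ℂ}
    (hS : ∀ p, p ≠ 0 → ¬ RegularAt f p →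
      p ∉ C.points ∧ p / q ∉ C.points ∧ C.index p = C.index (p / q)) :
    (C.integral fun z => f z - q * f (q * z)) = 0 := by
  have hint : ∀ c, ∀ u : ℝ → ℂ, Measurable u → ∀ K, IsCompact K → (∀ s, u s ∈ K) →
      (∀ z ∈ K, RegularAt f z) →
      Integrable (fun s => f (u s) * deriv (C.curve c) s) unitMeasure := by
    intro c u hu K hK hmem hreg
    have hb := boundedMeasurable_comp_of_regularAt hK hreg hu hmem
    obtain ⟨B, hB⟩ := hb.2
    exact (C.integrable_deriv c).bdd_mul hb.1.aestronglyMeasurable (Eventually.of_forall hB)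
  have h1 : ∀ c, Integrable (fun s => f (C.path c s) * deriv (C.curve c) s) unitMeasure := fun c =>
    hint c _ (C.continuous_path c).measurable _ C.isCompact_points (C.path_mem c) fun z hz =>
      by_contra fun h => (hS z (C.ne_zero_of_mem_points hz) h).1 hz
  have h2 : ∀ c, Integrable (fun s => q * f (q * C.path c s) * deriv (C.curve c) s) unitMeasure :=
    fun c => by
      simp_rw [mul_assoc q]
      refine (hint c (fun s => q * C.path c s) ((C.continuous_path c).measurable.const_mul q)
        ((fun z => q * z) '' C.points) (C.isCompact_points.image (continuous_const_mul q))
        (fun s => mem_image_of_mem _ (C.path_mem c s)) ?_).const_mul q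
      rintro _ ⟨z, hz, rfl⟩
      by_contra h
      refine (hS _ (mul_ne_zero hq (C.ne_zero_of_mem_points hz)) h).2.1 ?_
      rwa [mul_div_cancel_left₀ _ hq]
  have := C.integral_eq_integral_shift hq hS
  rw [← sub_eq_zero, integral_eq_path, integral_eq_path, ← Finset.sum_sub_distrib] at this
  rw [integral_eq_path, ← this]
  refine Finset.sum_congr rfl fun c _ => ?_
  rw [← MeasureTheory.integral_sub (h1 c) (h2 c)]
  simp_rw [sub_mul]

end Cycle

/-! ### Expectation values and the constraints -/

section Final

variable {q t : ℂ} {N : ℕ}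

theorem continuous_expLinearCoeff_modelSource (μ : ℕ+ →₀ ℕ) :
    Continuous fun x : Fin N → ℂ => expLinearCoeff (modelSource q t x) μ := by
  unfold expLinearCoeff modelSource Finsupp.prod
  fun_prop

theorem differentiable_expLinearCoeff_update (μ : ℕ+ →₀ ℕ) (x : Fin N → ℂ) (i : Fin N) :
    Differentiable ℂ fun z => expLinearCoeff (modelSource q t (Function.update x i z)) μ := by
  have hu : Differentiable ℂ fun z => Function.update x i z :=
    fun z => (hasDerivAt_update x i z).differentiableAt
  have hj : ∀ j, Differentiable ℂ fun z => Function.update x i z j := differentiable_pi.1 hu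
  unfold expLinearCoeff modelSource Finsupp.prod
  refine Differentiable.fun_finsetProd fun k _ => ?_
  fun_prop

theorem shiftFactor_update (c : ℂ) (x : Fin N → ℂ) (i : Fin N) (y z : ℂ) :
    shiftFactor c (Function.update x i y) i z = shiftFactor c x i z :=
  Finset.prod_congr rfl fun j hj => by rw [Function.update_of_ne (Finset.ne_of_mem_erase hj)]

variable {ω : ℂ → ℂ} {C : Fin N → Cycle}

theorem multiIntegrable_integrand_mul (hC : Admissible q t ω C) {g : (Fin N → ℂ) → ℂ}
    (hg : ContinuousOn g (univ.pi fun j => (C j).points)) :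
    MultiIntegrable C fun x => integrand q t ω x * g x :=
  multiIntegrable_of_regularAt hC.regular_weight hC.regular_kernel hg

/-- The shift factor depends only on the ratios x_i/x_j, so it can be absorbed into the kernel
factors, which cancel its poles at x_i = x_j. -/
theorem multiIntegrable_shiftFactor_mul (hq1 : ‖q‖ < 1) (ht : ∀ k : ℕ, q ^ k * t ≠ 1)
    (hC : Admissible q t ω C) (c : ℂ) (i : Fin N) {g : (Fin N → ℂ) → ℂ}
    (hg : ContinuousOn g (univ.pi fun j => (C j).points)) :
    MultiIntegrable C fun x => integrand q t ω x * (shiftFactor c x i (x i) * g x) := by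
  refine (multiIntegrable_of_regularAt (C := C) (ω := ω) (g := g)
    (R := fun a _ u => (if a = i then (c * u - 1) / (u - 1) else 1) * kernelFactor q t u)
    hC.regular_weight ?_ hg).congr fun x hx => ?_
  · intro a b hab x hx y hy
    have := hC.regular_kernel a b hab x hx y hy
    by_cases ha : a = i
    · simp only [if_pos ha]
      exact regularAt_ratio_mul_kernelFactor hq1 ht c this
    · simp only [if_neg ha, one_mul]
      exact this
  · have h1 : ∏ a, ∏ b ∈ Finset.univ.erase a,
        (if a = i then (c * (x a / x b) - 1) / (x a / x b - 1) else 1) =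
        shiftFactor c x i (x i) := by
      rw [Finset.prod_eq_single i (fun a _ ha => by simp [ha]) fun h => absurd (Finset.mem_univ i) h]
      refine Finset.prod_congr rfl fun b _ => ?_
      have hb : x b ≠ 0 := (C b).ne_zero_of_mem_points (hx b)
      rw [if_pos rfl, ← mul_div_assoc, div_sub_one hb, div_sub_one hb, div_div_div_cancel_right₀ hb]
    simp_rw [Finset.prod_mul_distrib]
    rw [h1, integrand, kernel]
    ring

/-- Finite combinations of coefficients commute with the expectation value. -/
theorem coeffSpan_generatingFunction (hC : Admissible q t ω C)
    {f : MvPowerSeries ℕ+ ℂ →ₗ[ℂ] ℂ} (hf : f ∈ coeffSpan) :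
    (MultiIntegrable C fun x => integrand q t ω x * f (expLinear (modelSource q t x))) ∧
      f (generatingFunction q t ω C) = (partitionFunction q t ω C)⁻¹ *
        multiIntegral C fun x => integrand q t ω x * f (expLinear (modelSource q t x)) := by
  induction hf using Submodule.span_induction with
  | mem f hf =>
    obtain ⟨ν, rfl⟩ := hf
    exact ⟨multiIntegrable_integrand_mul hC
      (continuous_expLinearCoeff_modelSource ν).continuousOn, rfl⟩
  | zero => simpa [multiIntegral_zero] using multiIntegrable_zero
  | add f g _ _ hf hg =>
    simp only [LinearMap.add_apply, mul_add]
    refine ⟨hf.1.add hg.1, ?_⟩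
    rw [multiIntegral_add hf.1 hg.1, hf.2, hg.2, mul_add]
  | smul a f _ hf =>
    simp only [LinearMap.smul_apply, smul_eq_mul, mul_left_comm _ a]
    refine ⟨hf.1.const_mul a, ?_⟩
    rw [multiIntegral_const_mul, hf.2, mul_left_comm]

/-- The total `q`-difference in the variable `x_i`. -/
def boundaryTerm (q t : ℂ) (ω : ℂ → ℂ) (Mplus Mminus : Polynomial ℂ) (m : ℤ) (μ : ℕ+ →₀ ℕ)
    (i : Fin N) (x : Fin N → ℂ) : ℂ :=
  integrand q t ω x * (shiftFactor t⁻¹ x i (x i) *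
      (Mminus.eval (x i) * x i ^ m * expLinearCoeff (modelSource q t x) μ) -
    q * (shiftFactor t x i (x i) * (Mplus.eval (q * x i) * (q * x i) ^ m *
      expLinearCoeff (modelSource q t (Function.update x i (q * x i))) μ)))

theorem multiIntegrable_boundaryTerm (hq0 : q ≠ 0) (hq1 : ‖q‖ < 1)
    (ht : ∀ k : ℕ, q ^ k * t ≠ 1) (hC : Admissible q t ω C) (Mplus Mminus : Polynomial ℂ) (m : ℤ)
    (μ : ℕ+ →₀ ℕ) (i : Fin N) :
    MultiIntegrable C (boundaryTerm q t ω Mplus Mminus m μ i) := by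
  have hxi : Continuous fun x : Fin N → ℂ => x i := continuous_apply i
  have hne : ∀ x ∈ univ.pi fun j => (C j).points, x i ≠ 0 := fun x hx =>
    (C i).ne_zero_of_mem_points (hx i (mem_univ i))
  have h1 := multiIntegrable_shiftFactor_mul hq1 ht hC t⁻¹ i
    (g := fun x => Mminus.eval (x i) * x i ^ m * expLinearCoeff (modelSource q t x) μ)
    (((Mminus.continuous.comp hxi).continuousOn.mul
      (hxi.continuousOn.zpow₀ m fun x hx => Or.inl (hne x hx))).mul
      (continuous_expLinearCoeff_modelSource μ).continuousOn)
  have hqx : Continuous fun x : Fin N → ℂ => q * x i := hxi.const_mul q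
  have h2 := multiIntegrable_shiftFactor_mul hq1 ht hC t i
    (g := fun x => Mplus.eval (q * x i) * (q * x i) ^ m *
      expLinearCoeff (modelSource q t (Function.update x i (q * x i))) μ)
    (((Mplus.continuous.comp hqx).continuousOn.mul
      (hqx.continuousOn.zpow₀ m fun x hx => Or.inl (mul_ne_zero hq0 (hne x hx)))).mul
      ((continuous_expLinearCoeff_modelSource μ).comp (continuous_id.update i hqx)).continuousOn)
  refine (h1.add (h2.const_mul (-q))).congr fun x _ => ?_
  rw [boundaryTerm]
  ring

/-- Integrating over x_i alone already gives zero, since the integrand there is f g - q (f g)(q ·)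
off finitely many contour points. The factor g is holomorphic on ℂ^×, so f g has no singularities
there beyond those of f, to which the q-shift condition applies. -/
theorem multiIntegral_boundaryTerm {logq logt : ℂ} {L : ℂ → ℂ} {w : ℂ → ℂ}
    (hq0 : q ≠ 0) (hq1 : ‖q‖ < 1) (ht0 : t ≠ 0) (ht : ∀ k : ℕ, q ^ k * t ≠ 1)
    (hlogq : Complex.exp logq = q) (hlogt : Complex.exp logt = t)
    (hLq : ∀ x, x ≠ 0 → L (q * x) = L x + logq)
    (hC : Admissible q t (weightFactor logq logt L N w) C)
    {Mplus Mminus : Polynomial ℂ} (hMp : Mplus ≠ 0) (hMm : Mminus ≠ 0)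
    (hw : ∀ z₀ : ℂ, z₀ ≠ 0 → ∀ᶠ z in 𝓝[≠] z₀,
      w z / w (q⁻¹ * z) = Mplus.eval z / Mminus.eval z)
    (m : ℤ) (μ : ℕ+ →₀ ℕ) (i : Fin N) :
    multiIntegral C (boundaryTerm q t (weightFactor logq logt L N w) Mplus Mminus m μ i) = 0 := by
  refine multiIntegral_eq_zero i (multiIntegrable_boundaryTerm hq0 hq1 ht hC Mplus Mminus m μ i)
    fun x hx => ?_
  set ω := weightFactor logq logt L N w with hω
  set g : ℂ → ℂ := fun z => Mminus.eval z * z ^ m *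
    expLinearCoeff (modelSource q t (Function.update x i z)) μ with hg
  set f : ℂ → ℂ := fun z => shiftFactor t⁻¹ x i z * integrand q t ω (Function.update x i z) with hf
  have hreg : ∀ p, p ≠ 0 → ¬ RegularAt (fun z => f z * g z) p → ¬ RegularAt f p := by
    intro p hp h hfp
    refine h (hfp.mul (AnalyticAt.regularAt ?_))
    exact ((Mminus.differentiable.analyticAt p).mul (analyticAt_id.zpow hp)).mul
      ((differentiable_expLinearCoeff_update μ x i).analyticAt p)
  have hzero := (C i).integral_sub_shift_eq_zero hq0 (f := fun z => f z * g z)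
    fun p hp h => hC.qshift i x hx p hp (hreg p hp h)
  rw [← hzero]
  refine (C i).integral_congr (finite_of_eventually_punctured (C i).isCompact_points
    fun p hp => ?_).countable
  filter_upwards [shiftFactor_mul_integrand_shift hq0 hq1 ht0 hlogq hlogt hLq w hMp hMm hw
    (fun j hj => (C j).ne_zero_of_mem_points (hx j hj)) ((C i).ne_zero_of_mem_points hp)] with z hz
  simp only [boundaryTerm, Function.update_self, Function.update_idem, shiftFactor_update, hf, hg]
  linear_combination q * (q * z) ^ m *
    expLinearCoeff (modelSource q t (Function.update x i (q * z))) μ * hz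

theorem virasoroMode_generatingFunction {logq logt : ℂ} {L : ℂ → ℂ} {w : ℂ → ℂ}
    (hq0 : q ≠ 0) (hq1 : ‖q‖ < 1) (ht0 : t ≠ 0) (hqt : ∀ m : ℕ, 1 ≤ m → q ^ m * t ≠ 1)
    (hlogq : Complex.exp logq = q) (hlogt : Complex.exp logt = t)
    (hLq : ∀ x, x ≠ 0 → L (q * x) = L x + logq)
    (hC : Admissible q t (weightFactor logq logt L N w) C)
    {Mplus Mminus : Polynomial ℂ} (hMp : Mplus ≠ 0) (hMm : Mminus ≠ 0)
    (hw : ∀ z₀ : ℂ, z₀ ≠ 0 → ∀ᶠ z in 𝓝[≠] z₀,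
      w z / w (q⁻¹ * z) = Mplus.eval z / Mminus.eval z)
    {m : ℤ} (hm : -1 ≤ m) (hM : m = -1 → Mplus.eval 0 = Mminus.eval 0) :
    virasoroMode q t N Mplus Mminus m
      (generatingFunction q t (weightFactor logq logt L N w) C) = 0 := by
  ext μ
  set ω := weightFactor logq logt L N w with hω
  obtain ⟨f, hf, hfF⟩ := exists_coeffSpan_virasoroMode q t N Mplus Mminus m μ
  rw [hfF, (coeffSpan_generatingFunction hC hf).2, map_zero]
  have hpt : multiIntegral C (fun x => integrand q t ω x * f (expLinear (modelSource q t x))) =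
      multiIntegral C fun x => (1 - t⁻¹) * ∑ i, boundaryTerm q t ω Mplus Mminus m μ i x := by
    refine multiIntegral_congr fun x hx => ?_
    have hx0 : ∀ i, x i ≠ 0 := fun i => (C i).ne_zero_of_mem_points (hx i)
    simp only [boundaryTerm, ← Finset.mul_sum]
    by_cases hinj : Function.Injective x
    · rw [← hfF, coeff_virasoroMode_expLinear hq0 hq1 ht0 hinj hx0 Mplus Mminus hm hM,
        mul_left_comm]
    · rw [integrand_eq_zero_of_not_injective hq1 ω hx0 hinj]
      simp
  rw [hpt, multiIntegral_const_mul]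
  -- For t = 1 the prefactor 1 - t⁻¹ vanishes. Otherwise q^k t ≠ 1 holds for k = 0 as well, as the
  -- integrability argument requires.
  by_cases ht1 : t = 1
  · simp [ht1]
  · have ht : ∀ k : ℕ, q ^ k * t ≠ 1 := fun k => by
      rcases Nat.eq_zero_or_pos k with rfl | hk
      · rwa [pow_zero, one_mul]
      · exact hqt k hk
    rw [multiIntegral_sum _ fun i _ => multiIntegrable_boundaryTerm hq0 hq1 ht hC Mplus Mminus m μ i,
      Finset.sum_eq_zero fun i _ => multiIntegral_boundaryTerm hq0 hq1 ht0 ht hlogq hlogt hLq hC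
        hMp hMm hw m μ i, mul_zero, mul_zero]

end Final

end

end QTVirasoro

end

theorem mainTheorem2 (N : ℕ) (q t logq logt : ℂ)
    (hq0 : q ≠ 0) (hq1 : ‖q‖ < 1) (ht0 : t ≠ 0)
    (hqt : ∀ m : ℕ, 1 ≤ m → q ^ m * t ≠ 1)
    (hlogq : Complex.exp logq = q) (hlogt : Complex.exp logt = t)
    (L : ℂ → ℂ) (hL : ∀ x, x ≠ 0 → Complex.exp (L x) = x)
    (hLq : ∀ x, x ≠ 0 → L (q * x) = L x + logq)
    (w : ℂ → ℂ) (C : Fin N → QTVirasoro.Cycle)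
    (hC : QTVirasoro.Admissible q t (QTVirasoro.weightFactor logq logt L N w) C)
    (hZ : QTVirasoro.partitionFunction q t (QTVirasoro.weightFactor logq logt L N w) C ≠ 0)
    (Mplus Mminus : Polynomial ℂ) (hMp : Mplus ≠ 0) (hMm : Mminus ≠ 0)
    (hdp : Mplus.natDegree ≤ 2) (hdm : Mminus.natDegree ≤ 2)
    (hw : ∀ z₀ : ℂ, z₀ ≠ 0 → ∀ᶠ z in nhdsWithin z₀ {z₀}ᶜ,
      w z / w (q⁻¹ * z) = Mplus.eval z / Mminus.eval z) :
    (∀ m : ℤ, 0 ≤ m →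
      QTVirasoro.virasoroMode q t N Mplus Mminus m
        (QTVirasoro.generatingFunction q t
          (QTVirasoro.weightFactor logq logt L N w) C) = 0) ∧
    (Mplus.eval 0 = Mminus.eval 0 → Mminus.eval 0 ≠ 0 → ∀ m : ℤ, -1 ≤ m →
      QTVirasoro.virasoroMode q t N Mplus Mminus m
        (QTVirasoro.generatingFunction q t
          (QTVirasoro.weightFactor logq logt L N w) C) = 0) := by
  exact ⟨fun m hm => QTVirasoro.virasoroMode_generatingFunction hq0 hq1 ht0 hqt hlogq hlogt hLq hC
      hMp hMm hw (by omega) fun h => absurd h (by omega),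
    fun h0 _ m hm => QTVirasoro.virasoroMode_generatingFunction hq0 hq1 ht0 hqt hlogq hlogt hLq hC
      hMp hMm hw hm fun _ => h0⟩
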